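/- Let $x_1,\dots,x_n$ be distinct points of $\mathbb R^3$, $x_i=(x_{i,1},x_{i,2},x_{i,3})$. For $i<j$ choose $z_{i,j},w_{i,j}\in\mathbb C$ with $|z_{i,j}|^2+|w_{i,j}|^2=1$ and $$\frac{z_{i,j}}{w_{i,j}}=\frac{(x_{j,1}-x_{i,1})+(x_{j,2}-x_{i,2})\sqrt{-1}}{\|x_j-x_i\|-(x_{j,3}-x_{i,3})},$$ where $w_{i,j}=0$ if the denominator on the right vanishes. For $i>j$ put $z_{i,j}=-\overline{w_{j,i}}$ and $w_{i,j}=\overline{z_{j,i}}$. Let $a_{i,j}$ be the coefficient at $t_1^{j-1}t_2^{n-j}$ of $f_i(t_1,t_2)=\prod_{k\ne i}(z_{i,k}t_1-w_{i,k}t_2)$. The Atiyah determinant is $D(x_1,\dots,x_n)=\det(a_{i,j})$. **Theorem.** For $n\ge 3$ let $x_1,\dots,x_n$ be the vertices, in any order, of a regular $n$-gon lying in any plane of $\mathbb R^3$. Then $D_n=|D(x_1,\dots,x_n)|$ depends only on $n$ (not on the polygon, the order of its vertices, or the choices of the $z_{i,j},w_{i,j}$), $$\lim_{n\to\infty}\frac{\ln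 D_n}{n^2}=\frac{7\zeta(3)}{2\pi^2}-\frac{\ln 2}{2}=0.07970480\ldots,$$ the digits shown being exact (that is, the constant lies in $[0.07970480,\,0.07970481)$), and $D_n>1$ for all $n\ge 3$. In particular the inequality $|D(x_1,\dots,x_n)|\ge 1$ (conjectured by Atiyah and Sutcliffe for all configurations of distinct points) holds for the vertices of every regular polygon. -/

import Mathlib

open Filter Topology

namespace Atiyah

/-- Euclidean space of dimension three; the coordinates of `p` are `p 0`, `p 1`, `p 2`. -/
abbrev Space : Type := EuclideanSpace ℝ (Fin 3)

/-- `‖q - p‖ - (q₃ - p₃)`, which vanishes exactly when `q - p` is a nonnegative multiple of the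
third basis vector. -/
noncomputable def den (p q : Space) : ℝ := ‖q - p‖ - (q 2 - p 2)

/-- `(q₁ - p₁) + (q₂ - p₂) √-1`. -/
noncomputable def num (p q : Space) : ℂ := ((q 0 - p 0 : ℝ) : ℂ) + ((q 1 - p 1 : ℝ) : ℂ) * Complex.I

/-- The families `z`, `w` of complex numbers are an admissible choice in the construction of the
determinant at the points `x`. Diagonal entries play no role. -/
structure IsChoice {n : ℕ} (x : Fin n → Space) (z w : Fin n → Fin n → ℂ) : Prop where
  normalized : ∀ i j, i < j → ‖z i j‖ ^ 2 + ‖w i j‖ ^ 2 = 1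
  ratio : ∀ i j, i < j → den (x i) (x j) ≠ 0 →
    w i j ≠ 0 ∧ z i j / w i j = num (x i) (x j) / (den (x i) (x j) : ℂ)
  pole : ∀ i j, i < j → den (x i) (x j) = 0 → w i j = 0
  z_of_gt : ∀ i j, j < i → z i j = -(starRingEnd ℂ) (w j i)
  w_of_gt : ∀ i j, j < i → w i j = (starRingEnd ℂ) (z j i)

/-- The binary form `f_i(t₁, t₂) = ∏_{k ≠ i} (z_{i,k} t₁ - w_{i,k} t₂)`; the variables `t₁`, `t₂`
are `X 0`, `X 1`. -/
noncomputable def form {n : ℕ} (z w : Fin n → Fin n → ℂ) (i : Fin n) : MvPolynomial (Fin 2) ℂ :=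
  ∏ k ∈ Finset.univ.erase i,
    (MvPolynomial.C (z i k) * MvPolynomial.X 0 - MvPolynomial.C (w i k) * MvPolynomial.X 1)

/-- The matrix of coefficients of the forms. Indices start at `0`, so column `j` holds the
coefficients at `t₁ ^ j * t₂ ^ (n - 1 - j)`. -/
noncomputable def coeffMatrix {n : ℕ} (z w : Fin n → Fin n → ℂ) : Matrix (Fin n) (Fin n) ℂ :=
  Matrix.of fun i j =>
    (form z w i).coeff (Finsupp.single 0 (j : ℕ) + Finsupp.single 1 (n - 1 - (j : ℕ)))

/-- `d` is a value of the Atiyah determinant at the points `x`, computed from some admissible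
choice. -/
def IsDet {n : ℕ} (x : Fin n → Space) (d : ℂ) : Prop :=
  ∃ z w : Fin n → Fin n → ℂ, IsChoice x z w ∧ d = (coeffMatrix z w).det

/-- `x` lists, in some order, the vertices of a regular `n`-gon in space: it has a center `c`, a
circumradius `r > 0`, and lies in the plane through `c` spanned by the orthonormal pair `u`, `v`. -/
def IsRegularPolygon {n : ℕ} (x : Fin n → Space) : Prop :=
  ∃ (c u v : Space) (r : ℝ) (σ : Equiv.Perm (Fin n)),
    0 < r ∧ ‖u‖ = 1 ∧ ‖v‖ = 1 ∧ inner ℝ u v = 0 ∧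
    ∀ k : Fin n, x (σ k) =
      c + r • (Real.cos (2 * Real.pi * (k : ℕ) / n) • u + Real.sin (2 * Real.pi * (k : ℕ) / n) • v)

/-- Admissible choices exist for all points, so the determinant always has a value. -/
theorem exists_isDet {n : ℕ} (x : Fin n → Space) : ∃ d, IsDet x d := by
  have key : ∀ p q : Space, ∃ zw : ℂ × ℂ, ‖zw.1‖ ^ 2 + ‖zw.2‖ ^ 2 = 1 ∧
      (den p q ≠ 0 → zw.2 ≠ 0 ∧ zw.1 / zw.2 = num p q / (den p q : ℂ)) ∧
      (den p q = 0 → zw.2 = 0) := by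
    intro p q
    by_cases h : den p q = 0
    · exact ⟨(1, 0), by simp, fun h' => absurd h h', fun _ => rfl⟩
    · have hpos : 0 < ‖num p q‖ ^ 2 + (den p q) ^ 2 := by positivity
      set s : ℝ := Real.sqrt (‖num p q‖ ^ 2 + (den p q) ^ 2) with hs
      have hs0 : 0 < s := Real.sqrt_pos.mpr hpos
      have hsq : s ^ 2 = ‖num p q‖ ^ 2 + (den p q) ^ 2 := Real.sq_sqrt hpos.le
      have hsc : (s : ℂ) ≠ 0 := by exact_mod_cast hs0.ne'
      have hdc : (den p q : ℂ) ≠ 0 := by exact_mod_cast h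
      refine ⟨(num p q / s, (den p q : ℂ) / s), ?_, fun _ => ⟨div_ne_zero hdc hsc, ?_⟩,
        fun h' => absurd h' h⟩
      · simp only [norm_div, Complex.norm_real, div_pow, Real.norm_eq_abs, sq_abs]
        rw [← add_div, ← hsq, div_self (by positivity)]
      · field_simp
  choose c h1 h2 h3 using key
  refine ⟨_, fun i j => if i < j then (c (x i) (x j)).1 else -(starRingEnd ℂ) (c (x j) (x i)).2,
    fun i j => if i < j then (c (x i) (x j)).2 else (starRingEnd ℂ) (c (x j) (x i)).1,
    ⟨?_, ?_, ?_, ?_, ?_⟩, rfl⟩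
  · intro i j h; simpa [h] using h1 _ _
  · intro i j h hd; simpa [h] using h2 _ _ hd
  · intro i j h hd; simpa [h] using h3 _ _ hd
  · intro i j h; simp [h, h.le.not_gt]
  · intro i j h; simp [h, h.le.not_gt]

/-- Regular polygons exist. -/
theorem exists_isRegularPolygon (n : ℕ) : ∃ x : Fin n → Space, IsRegularPolygon x :=
  ⟨fun k => (0 : Space) + (1 : ℝ) •
      (Real.cos (2 * Real.pi * (k : ℕ) / n) • EuclideanSpace.single (0 : Fin 3) (1 : ℝ) +
        Real.sin (2 * Real.pi * (k : ℕ) / n) • EuclideanSpace.single (1 : Fin 3) (1 : ℝ)),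
    0, EuclideanSpace.single 0 1, EuclideanSpace.single 1 1, 1, Equiv.refl _, one_pos,
    by simp, by simp, by simp [EuclideanSpace.inner_single_left], fun _ => rfl⟩

end Atiyah

/-! The pair (z_{i,j}, w_{i,j}) is a spinor, that is, a unit vector of ℂ² over the direction from
x_i to x_j, fixed up to a phase. In a unitary frame adapted to the plane of the polygon, the spinor
over the direction at angle θ is, up to a phase, (1, e^{iθ})/√2 (`exists_frame`). For the vertices j
and k one has e^{iθ} = ± i ζ^{j+k} with ζ = exp(πi/n) (`polygon_direction`).

Multiplying the coefficient matrix by a homogeneous Vandermonde matrix evaluates the forms at n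
points. At suitable points the form of vertex j becomes, up to a phase and a power of √2, ∏_{0<r<n}
(1 + ζ^r ζ^{2j} m). Gauss's product formula expands this in powers of ζ^{2j} m, so the matrix of
values is a product of diagonal matrices, a Fourier matrix and a Vandermonde matrix that cancels.
This gives |D| in closed form (`norm_sq_det`), as a function of n alone.

Taking logarithms turns the closed form into ln D_n = (n/2) ∑_{0<k<n} `density` (k/n)
(`log_norm_det`). The density is positive on (0, 1) except for a zero at 1/2, because it is even and
strictly convex about that point; hence D_n > 1. Its Riemann sums converge to its integral, which
reduces to ∫ y log(sin y) over [0, π/2], and the Fourier series of the second Bernoulli polynomial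
evaluates that through ζ(3). -/

namespace Atiyah

/-! ### Spinors over directions in space -/

/-- `(z, w)` is a unit vector of `ℂ²` whose image under the Hopf map is `m`. -/
structure IsSpinor (m : Space) (z w : ℂ) : Prop where
  norm_add : ‖z‖ ^ 2 + ‖w‖ ^ 2 = 1
  norm_sub : ‖z‖ ^ 2 - ‖w‖ ^ 2 = m 2
  mul_conj : 2 * (z * (starRingEnd ℂ) w) = (m 0 : ℂ) + (m 1 : ℂ) * Complex.I

theorem space_norm_sq (p : Space) : ‖p‖ ^ 2 = p 0 ^ 2 + p 1 ^ 2 + p 2 ^ 2 := by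
  rw [EuclideanSpace.real_norm_sq_eq, Fin.sum_univ_three]

theorem space_inner (p q : Space) : inner ℝ p q = p 0 * q 0 + p 1 * q 1 + p 2 * q 2 := by
  simp [PiLp.inner_apply, Fin.sum_univ_three, mul_comm]

/-- This matches the convention for z_{i,j}, w_{i,j} with i > j, so the order of the points stops
mattering. -/
theorem IsSpinor.antipode {m : Space} {z w : ℂ} (h : IsSpinor m z w) :
    IsSpinor (-m) (-(starRingEnd ℂ) w) ((starRingEnd ℂ) z) := by
  refine ⟨?_, ?_, ?_⟩
  · simpa [add_comm] using h.norm_add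
  · have := h.norm_sub
    simp only [norm_neg, RCLike.norm_conj, PiLp.neg_apply]
    linarith
  · have := h.mul_conj
    simp only [Complex.conj_conj, PiLp.neg_apply, Complex.ofReal_neg]
    linear_combination -this

/-- The prescribed ratio is the stereographic coordinate of the direction m: the distance r cancels,
and m₃ = 1 is the pole. Together with the normalization it forces |w|² = (1 - m₃)/2. -/
theorem isSpinor_of_ratio {p q m : Space} {r : ℝ} (hr : 0 < r) (hm : ‖m‖ = 1)
    (hpq : q - p = r • m) {z w : ℂ} (h1 : ‖z‖ ^ 2 + ‖w‖ ^ 2 = 1)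
    (h2 : den p q ≠ 0 → w ≠ 0 ∧ z / w = num p q / (den p q : ℂ))
    (h3 : den p q = 0 → w = 0) : IsSpinor m z w := by
  have hm2 : m 0 ^ 2 + m 1 ^ 2 + m 2 ^ 2 = 1 := by rw [← space_norm_sq, hm]; norm_num
  have hc : ∀ i, q i - p i = r * m i := fun i => by
    have := congrArg (fun y : Space => y i) hpq
    simpa using this
  have hden : den p q = r * (1 - m 2) := by
    rw [den, hpq, norm_smul, hm, hc, Real.norm_of_nonneg hr.le]; ring
  have hnum : num p q = r * ((m 0 : ℂ) + (m 1 : ℂ) * Complex.I) := by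
    rw [num, hc, hc]; push_cast; ring
  by_cases h : m 2 = 1
  · have hw : w = 0 := h3 (by rw [hden, h]; ring)
    subst hw
    have h0 : m 0 = 0 := by nlinarith [sq_nonneg (m 0), sq_nonneg (m 1)]
    have h1' : m 1 = 0 := by nlinarith [sq_nonneg (m 0), sq_nonneg (m 1)]
    exact ⟨h1, by rw [h, ← h1]; simp, by simp [h0, h1']⟩
  · have hs : 1 - m 2 ≠ 0 := fun h' => h (by linarith)
    obtain ⟨hw, hzw⟩ := h2 (by rw [hden]; exact mul_ne_zero hr.ne' hs)
    have hsC : (1 - m 2 : ℂ) ≠ 0 := by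
      rw [← Complex.ofReal_one, ← Complex.ofReal_sub]; exact Complex.ofReal_ne_zero.mpr hs
    have hrC : (r : ℂ) ≠ 0 := by exact_mod_cast hr.ne'
    have hz : z = w * (((m 0 : ℂ) + (m 1 : ℂ) * Complex.I) / (1 - m 2)) := by
      rw [hden, hnum] at hzw
      push_cast at hzw
      rw [mul_div_mul_left _ _ hrC] at hzw
      rw [← hzw]; field_simp
    have hnz : ‖z‖ ^ 2 * (1 - m 2) ^ 2 = ‖w‖ ^ 2 * (m 0 ^ 2 + m 1 ^ 2) := by
      have e1 : ‖(m 0 : ℂ) + (m 1 : ℂ) * Complex.I‖ ^ 2 = m 0 ^ 2 + m 1 ^ 2 := by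
        rw [Complex.sq_norm, Complex.normSq_add_mul_I]
      have e2 : ‖(1 - m 2 : ℂ)‖ ^ 2 = (1 - m 2) ^ 2 := by
        rw [← Complex.ofReal_one, ← Complex.ofReal_sub, Complex.norm_real, Real.norm_eq_abs, sq_abs]
      rw [hz, norm_mul, norm_div, mul_pow, div_pow, e1, e2]
      field_simp
    have hww : ‖w‖ ^ 2 = (1 - m 2) / 2 := by
      have e : m 0 ^ 2 + m 1 ^ 2 = (1 - m 2) * (1 + m 2) := by linarith
      rw [e] at hnz
      have : ‖z‖ ^ 2 * (1 - m 2) = ‖w‖ ^ 2 * (1 + m 2) := by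
        apply mul_left_cancel₀ hs; linarith
      have hz' : ‖z‖ ^ 2 = 1 - ‖w‖ ^ 2 := by linarith
      rw [hz'] at this
      linarith
    refine ⟨h1, by linarith, ?_⟩
    have hwc : w * (starRingEnd ℂ) w = ((1 - m 2) / 2 : ℂ) := by
      rw [Complex.mul_conj']
      have : ((‖w‖ ^ 2 : ℝ) : ℂ) = (((1 - m 2) / 2 : ℝ) : ℂ) := by rw [hww]
      push_cast at this
      exact this
    have : z * (starRingEnd ℂ) w =
        (w * (starRingEnd ℂ) w) * (((m 0 : ℂ) + (m 1 : ℂ) * Complex.I) / (1 - m 2)) := by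
      rw [hz]; ring
    rw [this, hwc]
    field_simp

theorem IsChoice.isSpinor {n : ℕ} {x : Fin n → Space} {z w : Fin n → Fin n → ℂ}
    (h : IsChoice x z w) {i j : Fin n} (hij : i ≠ j) {m : Space} {r : ℝ} (hr : 0 < r)
    (hm : ‖m‖ = 1) (hx : x j - x i = r • m) : IsSpinor m (z i j) (w i j) := by
  rcases lt_or_gt_of_ne hij with hlt | hlt
  · exact isSpinor_of_ratio hr hm hx (h.normalized i j hlt) (h.ratio i j hlt) (h.pole i j hlt)
  · have hx' : x i - x j = r • (-m) := by rw [smul_neg, ← hx, neg_sub]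
    have := isSpinor_of_ratio hr (by rwa [norm_neg]) hx' (h.normalized j i hlt) (h.ratio j i hlt)
      (h.pole j i hlt)
    rw [h.z_of_gt i j hlt, h.w_of_gt i j hlt]
    simpa using this.antipode

/-- The spinors over the unit circle of a plane, in a unitary frame adapted to the plane. -/
theorem exists_frame {u v : Space} (hu : ‖u‖ = 1) (hv : ‖v‖ = 1) (huv : inner ℝ u v = 0) :
    ∃ a b c d : ℂ, ‖a * d - b * c‖ = 1 ∧ ∀ (θ : ℝ) (z w : ℂ),
      IsSpinor (Real.cos θ • u + Real.sin θ • v) z w → ∃ l : ℂ, ‖l‖ = 1 ∧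
        (Real.sqrt 2 : ℂ) * z = l * (a + Complex.exp (θ * Complex.I) * c) ∧
        (Real.sqrt 2 : ℂ) * w = l * (b + Complex.exp (θ * Complex.I) * d) := by
  have hu2 : u 0 ^ 2 + u 1 ^ 2 + u 2 ^ 2 = 1 := by rw [← space_norm_sq, hu]; norm_num
  have hv2 : v 0 ^ 2 + v 1 ^ 2 + v 2 ^ 2 = 1 := by rw [← space_norm_sq, hv]; norm_num
  rw [space_inner] at huv
  have hu2C : (u 0 : ℂ) ^ 2 + (u 1 : ℂ) ^ 2 + (u 2 : ℂ) ^ 2 = 1 := by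
    simpa using congrArg Complex.ofReal hu2
  have hv2C : (v 0 : ℂ) ^ 2 + (v 1 : ℂ) ^ 2 + (v 2 : ℂ) ^ 2 = 1 := by
    simpa using congrArg Complex.ofReal hv2
  have huvC : (u 0 : ℂ) * v 0 + (u 1 : ℂ) * v 1 + (u 2 : ℂ) * v 2 = 0 := by
    simpa using congrArg Complex.ofReal huv
  have hI : Complex.I ^ 2 = -1 := Complex.I_sq
  -- To a vector m attach the Pauli-type matrix [[m₃, m₁ + i m₂], [m₁ - i m₂, -m₃]], which fixes the
  -- spinors over m when m is a unit vector. The matrix of v - iu is singular because v - iu is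
  -- isotropic; (a, b) is a unit vector in its kernel.
  obtain ⟨a, b, hab, k1, k2⟩ : ∃ a b : ℂ, a * (starRingEnd ℂ) a + b * (starRingEnd ℂ) b = 1 ∧
      (v 2 : ℂ) * a + (v 0 + v 1 * Complex.I) * b =
        Complex.I * (u 2 * a + (u 0 + u 1 * Complex.I) * b) ∧
      (v 0 - v 1 * Complex.I) * a - (v 2 : ℂ) * b =
        Complex.I * ((u 0 - u 1 * Complex.I) * a - u 2 * b) := by
    set M : Matrix (Fin 2) (Fin 2) ℂ :=
      !![v 2 - Complex.I * u 2, (v 0 + v 1 * Complex.I) - Complex.I * (u 0 + u 1 * Complex.I);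
        (v 0 - v 1 * Complex.I) - Complex.I * (u 0 - u 1 * Complex.I),
        -(v 2 : ℂ) + Complex.I * u 2] with hM
    have hdet : M.det = 0 := by
      rw [hM, Matrix.det_fin_two_of]
      linear_combination hu2C - hv2C +
        2 * Complex.I * huvC + ((v 1 : ℂ) ^ 2 - u 0 ^ 2 - u 2 ^ 2 - u 1 ^ 2 * (1 - Complex.I ^ 2) -
          2 * Complex.I * u 1 * v 1) * hI
    obtain ⟨e, he, hMe⟩ := Matrix.exists_mulVec_eq_zero_iff.mpr hdet
    have e1 := congrFun hMe 0
    have e2 := congrFun hMe 1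
    simp [hM, Matrix.mulVec, dotProduct, Fin.sum_univ_two] at e1 e2
    have hpos : 0 < ‖e 0‖ ^ 2 + ‖e 1‖ ^ 2 := by
      by_contra hcon
      apply he
      have h0 : ‖e 0‖ = 0 := by nlinarith [sq_nonneg ‖e 0‖, sq_nonneg ‖e 1‖]
      have h1 : ‖e 1‖ = 0 := by nlinarith [sq_nonneg ‖e 0‖, sq_nonneg ‖e 1‖]
      ext i
      fin_cases i
      · simpa using h0
      · simpa using h1
    set s : ℝ := Real.sqrt (‖e 0‖ ^ 2 + ‖e 1‖ ^ 2) with hs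
    have hs0 : 0 < s := Real.sqrt_pos.mpr hpos
    have hsq : s ^ 2 = ‖e 0‖ ^ 2 + ‖e 1‖ ^ 2 := Real.sq_sqrt hpos.le
    have hsC : (s : ℂ) ≠ 0 := by exact_mod_cast hs0.ne'
    have hsqC : (s : ℂ) ^ 2 = (‖e 0‖ : ℂ) ^ 2 + (‖e 1‖ : ℂ) ^ 2 := by exact_mod_cast hsq
    refine ⟨e 0 / s, e 1 / s, ?_, ?_, ?_⟩
    · simp only [map_div₀, Complex.conj_ofReal]
      rw [div_mul_div_comm, div_mul_div_comm, Complex.mul_conj', Complex.mul_conj', ← add_div,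
        ← hsqC, ← sq, div_self (pow_ne_zero 2 hsC)]
    · field_simp
      linear_combination e1
    · field_simp
      linear_combination e2
  -- (c, d) is the image of (a, b) under the matrix of u. The matrix of v then sends (a, b) to i(c,
  -- d) and (c, d) to -i(a, b).
  set c : ℂ := u 2 * a + (u 0 + u 1 * Complex.I) * b with hc
  set d : ℂ := (u 0 - u 1 * Complex.I) * a - u 2 * b with hd
  have k1c := congrArg (starRingEnd ℂ) k1
  have k2c := congrArg (starRingEnd ℂ) k2
  have hcc := congrArg (starRingEnd ℂ) hc
  have hdc := congrArg (starRingEnd ℂ) hd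
  simp only [map_add, map_sub, map_mul, Complex.conj_ofReal, Complex.conj_I] at k1c k2c hcc hdc
  have horth : (starRingEnd ℂ) a * c + (starRingEnd ℂ) b * d = 0 := by
    have : 2 * Complex.I * ((starRingEnd ℂ) a * c + (starRingEnd ℂ) b * d) = 0 := by
      linear_combination a * k1c + b * k2c - (starRingEnd ℂ) a * k1 - (starRingEnd ℂ) b * k2 -
        Complex.I * (a * hcc + b * hdc) + Complex.I * ((starRingEnd ℂ) a * hc + (starRingEnd ℂ) b * hd)
    simpa using this
  have horth' : a * (starRingEnd ℂ) c + b * (starRingEnd ℂ) d = 0 := by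
    simpa using congrArg (starRingEnd ℂ) horth
  have hcd : c * (starRingEnd ℂ) c + d * (starRingEnd ℂ) d = 1 := by
    rw [hcc, hdc, hc, hd]
    linear_combination ((u 0 : ℂ) ^ 2 + (u 1 : ℂ) ^ 2 + (u 2 : ℂ) ^ 2) * hab + hu2C -
      (u 1 : ℂ) ^ 2 * (a * (starRingEnd ℂ) a + b * (starRingEnd ℂ) b) * hI
  have u1 : (u 2 : ℂ) * c + (u 0 + u 1 * Complex.I) * d = a := by
    rw [hc, hd]; linear_combination a * hu2C - (u 1 : ℂ) ^ 2 * a * hI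
  have u2 : (u 0 - u 1 * Complex.I) * c - (u 2 : ℂ) * d = b := by
    rw [hc, hd]; linear_combination b * hu2C - (u 1 : ℂ) ^ 2 * b * hI
  have v1 : (v 2 : ℂ) * c + (v 0 + v 1 * Complex.I) * d = -Complex.I * a := by
    linear_combination -Complex.I * (a * hv2C - (v 1 : ℂ) ^ 2 * a * hI) +
      Complex.I * (v 2 * k1 + (v 0 + v 1 * Complex.I) * k2) +
      (v 2 * c + (v 0 + v 1 * Complex.I) * d) * hI
  have v2 : (v 0 - v 1 * Complex.I) * c - (v 2 : ℂ) * d = -Complex.I * b := by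
    linear_combination -Complex.I * (b * hv2C - (v 1 : ℂ) ^ 2 * b * hI) +
      Complex.I * ((v 0 - v 1 * Complex.I) * k1 - v 2 * k2) +
      ((v 0 - v 1 * Complex.I) * c - v 2 * d) * hI
  refine ⟨a, b, c, d, ?_, fun θ z w h => ?_⟩
  · have : (‖a * d - b * c‖ : ℂ) ^ 2 = 1 := by
      rw [← Complex.mul_conj']
      simp only [map_sub, map_mul]
      linear_combination (c * (starRingEnd ℂ) c + d * (starRingEnd ℂ) d) * hab + hcd -
        (a * (starRingEnd ℂ) c + b * (starRingEnd ℂ) d) * horth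
    have h2 : ‖a * d - b * c‖ ^ 2 = 1 := by exact_mod_cast this
    exact (pow_eq_one_iff_of_nonneg (norm_nonneg _) two_ne_zero).mp h2
  · have hm : ∀ i, ((Real.cos θ • u + Real.sin θ • v : Space) i : ℂ) =
        Complex.cos θ * u i + Complex.sin θ * v i := fun i => by
      simp
    have n1 : z * (starRingEnd ℂ) z + w * (starRingEnd ℂ) w = 1 := by
      rw [Complex.mul_conj', Complex.mul_conj']; exact_mod_cast h.norm_add
    have n2 : z * (starRingEnd ℂ) z - w * (starRingEnd ℂ) w =
        Complex.cos θ * u 2 + Complex.sin θ * v 2 := by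
      rw [Complex.mul_conj', Complex.mul_conj', ← hm, ← h.norm_sub]; push_cast; ring
    have n3 := h.mul_conj
    rw [hm, hm] at n3
    have n4 := congrArg (starRingEnd ℂ) n3
    simp only [map_add, map_mul, Complex.conj_conj, Complex.conj_ofReal, Complex.conj_I,
      ← Complex.ofReal_cos, ← Complex.ofReal_sin, map_ofNat] at n4
    rw [Complex.ofReal_cos, Complex.ofReal_sin] at n4
    have hcs : Complex.cos θ ^ 2 + Complex.sin θ ^ 2 = 1 := Complex.cos_sq_add_sin_sq _
    rw [Complex.exp_mul_I]
    have hcosc : (starRingEnd ℂ) (Complex.cos θ) = Complex.cos θ := by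
      rw [← Complex.cos_conj, Complex.conj_ofReal]
    have hsinc : (starRingEnd ℂ) (Complex.sin θ) = Complex.sin θ := by
      rw [← Complex.sin_conj, Complex.conj_ofReal]
    set C := Complex.cos θ
    set S := Complex.sin θ
    set p := a + (C + S * Complex.I) * c with hp
    set q := b + (C + S * Complex.I) * d with hq
    -- The matrix of the direction at angle θ fixes (p, q) = (a, b) + e^{iθ}(c, d). Its fixed space
    -- is the line of the spinor (z, w), so (p, q) = μ (z, w) with μ their Hermitian product;
    -- orthonormality of the frame gives |μ|² = 2.
    have f1 : (C * u 2 + S * v 2) * p +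
        (C * u 0 + S * v 0 + (C * u 1 + S * v 1) * Complex.I) * q = p := by
      rw [hp, hq]
      linear_combination -C * hc + S * k1 + (C + S * Complex.I) * (C * u1 + S * v1) + a * hcs -
        a * S ^ 2 * hI
    have f2 : (C * u 0 + S * v 0 - (C * u 1 + S * v 1) * Complex.I) * p -
        (C * u 2 + S * v 2) * q = q := by
      rw [hp, hq]
      linear_combination -C * hd + S * k2 + (C + S * Complex.I) * (C * u2 + S * v2) + b * hcs -
        b * S ^ 2 * hI
    set μ := (starRingEnd ℂ) z * p + (starRingEnd ℂ) w * q with hμ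
    have g1 : z * μ = p := by
      rw [hμ]; linear_combination (1 / 2) * (p * n1 + p * n2 + q * n3 + f1)
    have g2 : w * μ = q := by
      rw [hμ]; linear_combination (1 / 2) * (q * n1 - q * n2 + p * n4 + f2)
    have hpq : p * (starRingEnd ℂ) p + q * (starRingEnd ℂ) q = 2 := by
      rw [hp, hq]
      simp only [map_add, map_mul, Complex.conj_I, hcosc, hsinc]
      linear_combination hab + hcd + (C + S * Complex.I) * horth + (C - S * Complex.I) * horth' +
        (c * (starRingEnd ℂ) c + d * (starRingEnd ℂ) d) * (hcs - S ^ 2 * hI)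
    have hμn : (‖μ‖ : ℂ) ^ 2 = 2 := by
      rw [← Complex.mul_conj', ← hpq, ← g1, ← g2]
      simp only [map_mul]
      linear_combination -μ * (starRingEnd ℂ) μ * n1
    have hμ2 : ‖μ‖ ^ 2 = 2 := by exact_mod_cast hμn
    have hμs : ‖μ‖ = Real.sqrt 2 := by
      rw [← hμ2, Real.sqrt_sq (norm_nonneg _)]
    have hμ0 : μ ≠ 0 := by
      rintro h0
      rw [h0] at hμ2
      norm_num at hμ2
    refine ⟨(Real.sqrt 2 : ℂ) / μ, ?_, ?_, ?_⟩
    · rw [norm_div, hμs, Complex.norm_real, Real.norm_of_nonneg (Real.sqrt_nonneg _),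
        div_self (by positivity)]
    · rw [← g1]; field_simp
    · rw [← g2]; field_simp

/-! ### Evaluation of binary forms -/

theorem form_isHomogeneous {n : ℕ} (z w : Fin n → Fin n → ℂ) (i : Fin n) :
    (form z w i).IsHomogeneous (n - 1) := by
  have h := MvPolynomial.IsHomogeneous.prod (Finset.univ.erase i)
    (fun k => MvPolynomial.C (z i k) * (MvPolynomial.X 0 : MvPolynomial (Fin 2) ℂ) -
      MvPolynomial.C (w i k) * MvPolynomial.X 1) (fun _ => 1) (fun k _ =>
      (((MvPolynomial.isHomogeneous_C_mul_X _ _)).sub (MvPolynomial.isHomogeneous_C_mul_X _ _)))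
  have hc : ∑ _k ∈ Finset.univ.erase i, 1 = n - 1 := by simp
  rw [hc] at h
  exact h

theorem eval_eq_sum_of_isHomogeneous {N : ℕ} {p : MvPolynomial (Fin 2) ℂ}
    (hp : p.IsHomogeneous N) (s t : ℂ) :
    MvPolynomial.eval ![s, t] p = ∑ j ∈ Finset.range (N + 1),
      p.coeff (Finsupp.single 0 j + Finsupp.single 1 (N - j)) * (s ^ j * t ^ (N - j)) := by
  rw [MvPolynomial.eval_eq']
  have hinj : Set.InjOn (fun j : ℕ => (Finsupp.single 0 j + Finsupp.single 1 (N - j) : Fin 2 →₀ ℕ))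
      (Finset.range (N + 1)) := by
    intro a _ b _ hab
    have := DFunLike.congr_fun hab 0
    simpa using this
  have hsub : p.support ⊆ (Finset.range (N + 1)).image
      (fun j : ℕ => (Finsupp.single 0 j + Finsupp.single 1 (N - j) : Fin 2 →₀ ℕ)) := by
    intro e he
    have hdeg := hp (MvPolynomial.mem_support_iff.mp he)
    have hdeg : e.degree = N :=
      (DFunLike.congr_fun (Finsupp.degree_eq_weight_one (R := ℕ)) e).trans hdeg
    rw [Finsupp.degree_eq_sum, Fin.sum_univ_two] at hdeg
    simp only [Finset.mem_image, Finset.mem_range]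
    refine ⟨e 0, by omega, ?_⟩
    ext k
    fin_cases k
    · simp
    · simp; omega
  rw [Finset.sum_subset hsub (fun e _ he => by
    rw [MvPolynomial.notMem_support_iff.mp he, zero_mul]), Finset.sum_image hinj]
  refine Finset.sum_congr rfl fun j _ => ?_
  simp [Fin.prod_univ_two]

theorem eval_form {n : ℕ} (z w : Fin n → Fin n → ℂ) (i : Fin n) (s t : ℂ) :
    MvPolynomial.eval ![s, t] (form z w i) = ∏ k ∈ Finset.univ.erase i, (z i k * s - w i k * t) := by
  rw [form, MvPolynomial.eval_prod]
  simp

theorem coeffMatrix_mul_projVandermonde {n : ℕ} (z w : Fin n → Fin n → ℂ) (T S : Fin n → ℂ) :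
    coeffMatrix z w * (Matrix.projVandermonde T S).transpose =
      Matrix.of fun i m => ∏ k ∈ Finset.univ.erase i, (z i k * T m - w i k * S m) := by
  ext i m
  have hn : n - 1 + 1 = n := Nat.sub_add_cancel (Fin.pos i)
  rw [Matrix.of_apply, ← eval_form, eval_eq_sum_of_isHomogeneous (form_isHomogeneous z w i), hn,
    Finset.sum_range, Matrix.mul_apply]
  refine Finset.sum_congr rfl fun j _ => ?_
  rw [Matrix.transpose_apply, Matrix.projVandermonde_apply, coeffMatrix, Matrix.of_apply,
    Fin.val_rev, show n - (j.val + 1) = n - 1 - j.val by omega]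

/-- Every 2 × 2 minor in the product formula scales by ad - bc, and there are n(n - 1)/2 of them. A
frame change of unit determinant modulus thus preserves the modulus. -/
theorem det_projVandermonde_linear {n : ℕ} (a b c d : ℂ) (T S : Fin n → ℂ) :
    (Matrix.projVandermonde (fun m => a * T m + b * S m) (fun m => c * T m + d * S m)).det =
      (a * d - b * c) ^ (n * (n - 1) / 2) * (Matrix.projVandermonde T S).det := by
  rw [Matrix.det_projVandermonde, Matrix.det_projVandermonde]
  have h : ∀ i j : Fin n, (a * T j + b * S j) * (c * T i + d * S i) -
      (a * T i + b * S i) * (c * T j + d * S j) = (a * d - b * c) * (T j * S i - T i * S j) :=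
    fun i j => by ring
  simp only [h, Finset.prod_mul_distrib, Finset.prod_const, Finset.prod_pow_eq_pow_sum,
    Fin.card_Ioi]
  congr 2
  rw [← Finset.sum_range (fun i => n - 1 - i), Finset.sum_range_reflect (fun i => i),
    Finset.sum_range_id]

/-! ### The Gauss product -/

/-- The coefficients of `∏_{0 < m < n} (1 + ζ ^ m X)`, where `ζ ^ n = -1`. -/
noncomputable def gaussCoeff (ζ : ℂ) (l : ℕ) : ℂ :=
  ∏ k ∈ Finset.range l, (1 + ζ ^ (k + 1)) / (1 - ζ ^ (k + 1))

theorem gaussCoeff_succ (ζ : ℂ) (l : ℕ) :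
    gaussCoeff ζ (l + 1) = gaussCoeff ζ l * ((1 + ζ ^ (l + 1)) / (1 - ζ ^ (l + 1))) :=
  Finset.prod_range_succ _ _

open Polynomial in
-- The product satisfies P(ζX)(1 + ζX) = P(X)(1 + ζ^n X) = P(X)(1 - X). Comparing coefficients gives
-- the recursion that defines `gaussCoeff`.
theorem coeff_prod_one_add_pow_mul_X {n : ℕ} (hn : 0 < n) {ζ : ℂ} (h1 : ζ ^ n = -1)
    (h2 : ∀ k, 0 < k → k < n → ζ ^ k ≠ 1) {l : ℕ} (hl : l < n) :
    (∏ m ∈ Finset.Ico 1 n, (1 + C (ζ ^ m) * X)).coeff l = gaussCoeff ζ l := by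
  set P : ℂ[X] := ∏ m ∈ Finset.Ico 1 n, (1 + C (ζ ^ m) * X) with hP
  have hfun : P.comp (C ζ * X) * (1 + C ζ * X) = P * (1 - X) := by
    have e1 : P.comp (C ζ * X) = ∏ m ∈ Finset.Ico 1 n, (1 + C (ζ ^ (m + 1)) * X) := by
      rw [hP, prod_comp]
      refine Finset.prod_congr rfl fun m _ => ?_
      simp only [add_comp, one_comp, mul_comp, C_comp, X_comp, pow_succ, map_mul]
      ring
    have e2 : (1 - X : ℂ[X]) = 1 + C (ζ ^ n) * X := by rw [h1]; simp; ring
    have e3 : (1 + C ζ * X : ℂ[X]) = 1 + C (ζ ^ 1) * X := by rw [pow_one]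
    rw [e1, e2, hP, ← Finset.prod_Ico_succ_top hn,
      Finset.prod_Ico_add' (fun m => (1 + C (ζ ^ m) * X : ℂ[X])) 1 n 1, e3, mul_comm,
      ← Finset.prod_eq_prod_Ico_succ_bot (by omega : 1 < n + 1) (fun m => (1 + C (ζ ^ m) * X : ℂ[X]))]
  induction l with
  | zero =>
    rw [coeff_zero_eq_eval_zero, hP, eval_prod]
    simp [gaussCoeff]
  | succ l ih =>
    have ih := ih (by omega)
    have hc := congrArg (fun p : ℂ[X] => p.coeff (l + 1)) hfun
    simp only [mul_add, mul_sub, mul_one, coeff_add, coeff_sub, comp_C_mul_X_coeff] at hc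
    rw [mul_left_comm, coeff_C_mul, coeff_mul_X, coeff_mul_X, comp_C_mul_X_coeff, ih] at hc
    have hne : 1 - ζ ^ (l + 1) ≠ 0 := sub_ne_zero.mpr (h2 (l + 1) (by omega) hl).symm
    rw [gaussCoeff_succ]
    field_simp
    linear_combination -hc

open Polynomial in
theorem prod_one_add_pow_mul {n : ℕ} (hn : 0 < n) {ζ : ℂ} (h1 : ζ ^ n = -1)
    (h2 : ∀ k, 0 < k → k < n → ζ ^ k ≠ 1) (y : ℂ) :
    ∏ m ∈ Finset.Ico 1 n, (1 + ζ ^ m * y) = ∑ l ∈ Finset.range n, gaussCoeff ζ l * y ^ l := by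
  have hdeg : (∏ m ∈ Finset.Ico 1 n, (1 + C (ζ ^ m) * X)).natDegree < n := by
    refine (natDegree_prod_le _ _).trans_lt ?_
    calc ∑ m ∈ Finset.Ico 1 n, (1 + C (ζ ^ m) * X : ℂ[X]).natDegree
        ≤ ∑ m ∈ Finset.Ico 1 n, 1 := Finset.sum_le_sum fun m _ => by compute_degree
      _ < n := by simp; omega
  have h := eval_eq_sum_range' hdeg y
  rw [eval_prod] at h
  simp only [eval_add, eval_one, eval_mul, eval_C, eval_X] at h
  rw [h]
  refine Finset.sum_congr rfl fun l hl => ?_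
  rw [coeff_prod_one_add_pow_mul_X hn h1 h2 (Finset.mem_range.mp hl)]

/-! ### The discrete Fourier matrix -/

/-- Orthogonality of characters: V V* = n · 1. -/
theorem normSq_det_vandermonde_roots {n : ℕ} {ω : ℂ} (hω : IsPrimitiveRoot ω n) :
    ‖(Matrix.vandermonde fun j : Fin n => ω ^ (j : ℕ)).det‖ ^ 2 = (n : ℝ) ^ n := by
  rcases Nat.eq_zero_or_pos n with rfl | hn
  · simp
  have hnorm : ‖ω‖ = 1 := hω.norm'_eq_one hn.ne'
  have hω0 : ω ≠ 0 := hω.ne_zero hn.ne'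
  have hconj : (starRingEnd ℂ) ω = ω⁻¹ := (Complex.inv_eq_conj hnorm).symm
  set V := Matrix.vandermonde fun j : Fin n => ω ^ (j : ℕ) with hV
  have hmul : V * V.conjTranspose = (n : ℂ) • (1 : Matrix (Fin n) (Fin n) ℂ) := by
    ext i j
    rw [Matrix.mul_apply]
    simp only [hV, Matrix.conjTranspose_apply, Matrix.vandermonde_apply, Matrix.smul_apply,
      smul_eq_mul, star_pow]
    have e : ∀ l : Fin n, (ω ^ (i : ℕ)) ^ (l : ℕ) * (star ω ^ (j : ℕ)) ^ (l : ℕ) =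
        (ω ^ (i : ℕ) * (ω ^ (j : ℕ))⁻¹) ^ (l : ℕ) := fun l => by
      rw [← starRingEnd_apply, hconj, inv_pow, mul_pow]
    simp only [e]
    rw [← Finset.sum_range (fun l => (ω ^ (i : ℕ) * (ω ^ (j : ℕ))⁻¹) ^ l)]
    by_cases hij : i = j
    · subst hij
      rw [mul_inv_cancel₀ (pow_ne_zero _ hω0)]
      simp
    · rw [Matrix.one_apply_ne hij, mul_zero]
      have hne : ω ^ (i : ℕ) * (ω ^ (j : ℕ))⁻¹ ≠ 1 := by
        intro h
        apply hij
        rw [mul_inv_eq_one₀ (pow_ne_zero _ hω0)] at h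
        exact Fin.ext (hω.pow_inj i.2 j.2 h)
      have hroot : ∀ k : ℕ, (ω ^ k) ^ n = 1 := fun k => by
        rw [pow_right_comm, hω.pow_eq_one, one_pow]
      have h1 : (ω ^ (i : ℕ) * (ω ^ (j : ℕ))⁻¹) ^ n = 1 := by
        rw [mul_pow, inv_pow, hroot, hroot, inv_one, mul_one]
      rw [geom_sum_eq hne, h1, sub_self, zero_div]
  have hdet := congrArg Matrix.det hmul
  rw [Matrix.det_mul, Matrix.det_conjTranspose, Matrix.det_smul, Matrix.det_one, mul_one,
    Fintype.card_fin, ← starRingEnd_apply, Complex.mul_conj'] at hdet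
  exact_mod_cast hdet

/-! ### The determinant of a regular polygon -/

/-- The root of unity `exp (π √-1 / n)`. -/
noncomputable def halfRoot (n : ℕ) : ℂ := Complex.exp ((Real.pi / n : ℝ) * Complex.I)

theorem halfRoot_pow (n k : ℕ) :
    halfRoot n ^ k = Complex.exp ((Real.pi * k / n : ℝ) * Complex.I) := by
  rw [halfRoot, ← Complex.exp_nat_mul]
  congr 1
  push_cast
  ring

theorem halfRoot_pow_self {n : ℕ} (hn : 0 < n) : halfRoot n ^ n = -1 := by
  have : (n : ℝ) ≠ 0 := by positivity
  rw [halfRoot_pow, mul_div_cancel_right₀ _ this, Complex.exp_pi_mul_I]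

theorem isPrimitiveRoot_halfRoot {n : ℕ} (hn : 0 < n) : IsPrimitiveRoot (halfRoot n) (2 * n) := by
  have h := Complex.isPrimitiveRoot_exp (2 * n) (by omega)
  have hn' : (n : ℂ) ≠ 0 := by exact_mod_cast hn.ne'
  have e : 2 * (Real.pi : ℂ) * Complex.I / ((2 * n : ℕ) : ℂ) = (Real.pi / n : ℝ) * Complex.I := by
    push_cast
    field_simp
  rwa [e] at h

/-- Reindex by m = k - j modulo n, so that j + k = m + 2j up to n. The wrap-around costs ζ^n = -1,
which is exactly the sign for k < j. -/
theorem prod_erase_one_add_sign {n : ℕ} {ζ : ℂ} (h1 : ζ ^ n = -1) (j : Fin n) (y : ℂ) :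
    ∏ k ∈ Finset.univ.erase j, (1 + (if j < k then ζ ^ (j + k : ℕ) else -ζ ^ (j + k : ℕ)) * y) =
      ∏ m ∈ Finset.Ico 1 n, (1 + ζ ^ m * ((ζ ^ 2) ^ (j : ℕ) * y)) := by
  refine Finset.prod_bij (fun k _ => if j < k then (k - j : ℕ) else n + k - j) ?_ ?_ ?_ ?_
  · intro k hk
    have hk := Finset.ne_of_mem_erase hk
    have := j.2
    have := k.2
    have : (k : ℕ) ≠ j := fun h => hk (Fin.ext h)
    simp only [Finset.mem_Ico, Fin.lt_def]
    split_ifs <;> omega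
  · intro k hk k' hk' h
    have := j.2
    have := k.2
    have := k'.2
    simp only [Fin.lt_def] at h
    apply Fin.ext
    split_ifs at h <;> omega
  · intro m hm
    rw [Finset.mem_Ico] at hm
    have hj := j.2
    by_cases hmj : j + m < n
    · refine ⟨⟨j + m, hmj⟩, Finset.mem_erase.mpr ⟨?_, Finset.mem_univ _⟩, ?_⟩
      · intro h; have := congrArg Fin.val h; simp at this; omega
      · simp only [Fin.lt_def]; split_ifs <;> omega
    · refine ⟨⟨j + m - n, by omega⟩, Finset.mem_erase.mpr ⟨?_, Finset.mem_univ _⟩, ?_⟩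
      · intro h; have := congrArg Fin.val h; simp at this; omega
      · simp only [Fin.lt_def]; split_ifs <;> omega
  · intro k hk
    have := j.2
    rw [← pow_mul, ← mul_assoc, ← pow_add]
    simp only [Fin.lt_def]
    split_ifs with h
    · rw [show (k - j + 2 * j : ℕ) = j + k by omega]
    · rw [show (n + k - j + 2 * j : ℕ) = n + (j + k) by omega, pow_add _ n, h1, neg_one_mul]

/-- The chord is perpendicular to the mid-angle π(j + k)/n; the order of j and k decides between
adding and subtracting π/2. -/
theorem polygon_direction {n : ℕ} (hn : 0 < n) (c u v : Space) {r : ℝ} (hr : 0 < r) {j k : Fin n}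
    (hjk : j ≠ k) : ∃ ρ θ : ℝ, 0 < ρ ∧
      (c + r • (Real.cos (2 * Real.pi * (k : ℕ) / n) • u +
          Real.sin (2 * Real.pi * (k : ℕ) / n) • v)) -
        (c + r • (Real.cos (2 * Real.pi * (j : ℕ) / n) • u +
          Real.sin (2 * Real.pi * (j : ℕ) / n) • v)) = ρ • (Real.cos θ • u + Real.sin θ • v) ∧
      Complex.exp (θ * Complex.I) =
        (if j < k then halfRoot n ^ (j + k : ℕ) else -halfRoot n ^ (j + k : ℕ)) * Complex.I := by
  have hn' : (0 : ℝ) < n := by exact_mod_cast hn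
  set φ : ℝ := Real.pi * (j + k : ℕ) / n with hφ
  set ψ : ℝ := Real.pi * ((k : ℕ) - (j : ℕ) : ℝ) / n with hψ
  have ek : 2 * Real.pi * (k : ℕ) / n = φ + ψ := by rw [hφ, hψ]; push_cast; ring
  have ej : 2 * Real.pi * (j : ℕ) / n = φ - ψ := by rw [hφ, hψ]; push_cast; ring
  have hsub : (c + r • (Real.cos (2 * Real.pi * (k : ℕ) / n) • u +
          Real.sin (2 * Real.pi * (k : ℕ) / n) • v)) -
        (c + r • (Real.cos (2 * Real.pi * (j : ℕ) / n) • u +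
          Real.sin (2 * Real.pi * (j : ℕ) / n) • v)) =
      (2 * r * Real.sin ψ) • (-Real.sin φ • u + Real.cos φ • v) := by
    rw [ek, ej, Real.cos_add, Real.cos_sub, Real.sin_add, Real.sin_sub]
    module
  rw [hsub, halfRoot_pow, ← hφ]
  have hkn : ((k : ℕ) : ℝ) < n := by exact_mod_cast k.2
  have hjn : ((j : ℕ) : ℝ) < n := by exact_mod_cast j.2
  have hk0 : (0 : ℝ) ≤ (k : ℕ) := Nat.cast_nonneg _
  have hj0 : (0 : ℝ) ≤ (j : ℕ) := Nat.cast_nonneg _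
  have hpi := Real.pi_pos
  rcases lt_or_gt_of_ne hjk with h | h
  · have h' : ((j : ℕ) : ℝ) < (k : ℕ) := by exact_mod_cast h
    refine ⟨2 * r * Real.sin ψ, φ + Real.pi / 2, ?_, ?_, ?_⟩
    · have : 0 < Real.sin ψ := by
        apply Real.sin_pos_of_pos_of_lt_pi
        · rw [hψ]; have := sub_pos.mpr h'; positivity
        · rw [hψ, div_lt_iff₀ hn']; nlinarith
      positivity
    · rw [Real.cos_add_pi_div_two, Real.sin_add_pi_div_two]
    · rw [if_pos h]; push_cast
      rw [add_mul, Complex.exp_add, Complex.exp_pi_div_two_mul_I]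
  · have h' : ((k : ℕ) : ℝ) < (j : ℕ) := by exact_mod_cast h
    refine ⟨-(2 * r * Real.sin ψ), φ - Real.pi / 2, ?_, ?_, ?_⟩
    · have : 0 < Real.sin (-ψ) := by
        apply Real.sin_pos_of_pos_of_lt_pi
        · rw [hψ, ← neg_div, ← mul_neg, neg_sub]; have := sub_pos.mpr h'; positivity
        · rw [hψ, ← neg_div, ← mul_neg, neg_sub, div_lt_iff₀ hn']; nlinarith
      rw [Real.sin_neg] at this
      have h3 : 0 < 2 * r * -Real.sin ψ := by positivity
      linarith
    · rw [Real.cos_sub_pi_div_two, Real.sin_sub_pi_div_two]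
      module
    · rw [if_neg (not_lt.mpr h.le)]; push_cast
      rw [sub_mul, sub_eq_add_neg, Complex.exp_add, ← neg_mul, ← neg_div,
        Complex.exp_neg_pi_div_two_mul_I]
      ring

theorem norm_sq_det {n : ℕ} (hn : 0 < n) {x : Fin n → Space} (hx : IsRegularPolygon x) {D : ℂ}
    (hD : IsDet x D) :
    (2 : ℝ) ^ (n * (n - 1)) * ‖D‖ ^ 2 =
      (n : ℝ) ^ n * (∏ l ∈ Finset.range n, ‖gaussCoeff (halfRoot n) l‖) ^ 2 := by
  obtain ⟨o, u, v, r, σ, hr, hu, hv, huv, hx⟩ := hx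
  obtain ⟨z, w, hzw, rfl⟩ := hD
  obtain ⟨a, b, c, d, hΔ, hframe⟩ := exists_frame hu hv huv
  set ζ := halfRoot n with hζ
  have hζ1 : ζ ^ n = -1 := halfRoot_pow_self hn
  have hprim : IsPrimitiveRoot ζ (2 * n) := isPrimitiveRoot_halfRoot hn
  have hζ2 : ∀ k, 0 < k → k < n → ζ ^ k ≠ 1 := fun k h0 h1 =>
    hprim.pow_ne_one_of_pos_of_lt h0.ne' (by omega)
  have hω : IsPrimitiveRoot (ζ ^ 2) n := hprim.pow (by omega) rfl
  have hspin : ∀ j k : Fin n, ∃ l : ℂ, ‖l‖ = 1 ∧ (j ≠ k → ∀ s t : ℂ,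
      (Real.sqrt 2 : ℂ) * (z (σ j) (σ k) * s - w (σ j) (σ k) * t) = l * ((a * s - b * t) +
        ((if j < k then ζ ^ (j + k : ℕ) else -ζ ^ (j + k : ℕ)) * Complex.I) *
          (c * s - d * t))) := by
    intro j k
    by_cases hjk : j = k
    · exact ⟨1, norm_one, fun h => absurd hjk h⟩
    obtain ⟨ρ, θ, hρ, hdir, hexp⟩ := polygon_direction hn o u v hr hjk
    have hm : ‖Real.cos θ • u + Real.sin θ • v‖ = 1 := by
      have : ‖Real.cos θ • u + Real.sin θ • v‖ ^ 2 = 1 := by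
        rw [norm_add_sq_real, norm_smul, norm_smul, hu, hv, inner_smul_left, inner_smul_right, huv]
        simp
      exact (pow_eq_one_iff_of_nonneg (norm_nonneg _) two_ne_zero).mp this
    have hsp := hzw.isSpinor (σ.injective.ne hjk) hρ hm (by rw [hx, hx]; exact hdir)
    obtain ⟨l, hl, e1, e2⟩ := hframe θ _ _ hsp
    refine ⟨l, hl, fun _ s t => ?_⟩
    rw [← hexp]
    linear_combination s * e1 - t * e2
  choose l hl hfac using hspin
  have hΔ0 : a * d - b * c ≠ 0 := by
    intro h; rw [h] at hΔ; simp at hΔ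
  set Δ := a * d - b * c with hΔd
  -- The evaluation points solve aT - bS = 1 and cT - dS = -im, so each linear factor becomes a
  -- phase times 1 ± ζ^{j+k} m.
  set T : Fin n → ℂ := fun m => (Complex.I * b / Δ) * (m : ℕ) + (d / Δ) * 1 with hT
  set S : Fin n → ℂ := fun m => (Complex.I * a / Δ) * (m : ℕ) + (c / Δ) * 1 with hS
  have hTS1 : ∀ m, a * T m - b * S m = 1 := fun m => by
    simp only [hT, hS]; field_simp; rw [hΔd]; ring
  have hTS2 : ∀ m, c * T m - d * S m = -Complex.I * (m : ℕ) := fun m => by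
    simp only [hT, hS]; field_simp; rw [hΔd]; ring
  set W : Matrix (Fin n) (Fin n) ℂ := Matrix.vandermonde fun m : Fin n => ((m : ℕ) : ℂ) with hW
  have hW0 : W.det ≠ 0 := by
    rw [hW, Matrix.det_vandermonde_ne_zero_iff]
    intro p q hpq
    exact Fin.ext (Nat.cast_injective (R := ℂ) hpq)
  have hVn : ‖(Matrix.projVandermonde T S).det‖ = ‖W.det‖ := by
    rw [hT, hS, det_projVandermonde_linear (Complex.I * b / Δ) (d / Δ) (Complex.I * a / Δ) (c / Δ)
      (fun m : Fin n => ((m : ℕ) : ℂ)) (fun _ => 1), hW, Matrix.vandermonde_eq_projVandermonde,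
      norm_mul, norm_pow]
    have : Complex.I * b / Δ * (c / Δ) - d / Δ * (Complex.I * a / Δ) = -Complex.I / Δ := by
      field_simp; rw [hΔd]; ring
    rw [this, norm_div, norm_neg, Complex.norm_I, hΔ, div_one, one_pow, one_mul]
    rfl
  set E := Matrix.of fun i m => ∏ k ∈ Finset.univ.erase i, (z i k * T m - w i k * S m) with hE
  have hCE : coeffMatrix z w * (Matrix.projVandermonde T S).transpose = E :=
    coeffMatrix_mul_projVandermonde z w T S
  set L : Fin n → ℂ := fun j => ∏ k ∈ Finset.univ.erase j, l j k with hL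
  -- Entry (j, m) is a phase times ∑ g_l ζ^{2jl} m^l, with g_l the Gauss coefficients: separating j,
  -- l and m gives the four factors.
  have hfactor : ((Real.sqrt 2 : ℂ) ^ (n - 1)) • E.submatrix σ id =
      Matrix.diagonal L * (Matrix.vandermonde fun j : Fin n => (ζ ^ 2) ^ (j : ℕ)) *
        Matrix.diagonal (fun i : Fin n => gaussCoeff ζ i) * W.transpose := by
    ext j m
    rw [Matrix.mul_apply]
    simp only [Matrix.mul_diagonal, Matrix.diagonal_mul, Matrix.vandermonde_apply,
      Matrix.transpose_apply, Matrix.smul_apply, Matrix.submatrix_apply, id, hE, Matrix.of_apply,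
      smul_eq_mul, hW]
    have himg : Finset.univ.erase (σ j) = (Finset.univ.erase j).map σ.toEmbedding := by
      ext k
      simp
    have hcard : (Finset.univ.erase j).card = n - 1 := by simp
    rw [himg, Finset.prod_map, ← hcard, ← Finset.prod_const, ← Finset.prod_mul_distrib]
    have : ∀ k ∈ Finset.univ.erase j, (Real.sqrt 2 : ℂ) *
        (z (σ j) (σ.toEmbedding k) * T m - w (σ j) (σ.toEmbedding k) * S m) =
        l j k * (1 + (if j < k then ζ ^ (j + k : ℕ) else -ζ ^ (j + k : ℕ)) * (m : ℕ)) := by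
      intro k hk
      rw [Equiv.toEmbedding_apply, hfac j k (Finset.ne_of_mem_erase hk).symm, hTS1, hTS2]
      linear_combination
        -(l j k * (if j < k then ζ ^ (j + k : ℕ) else -ζ ^ (j + k : ℕ)) * (m : ℕ)) * Complex.I_sq
    rw [Finset.prod_congr rfl this, Finset.prod_mul_distrib, prod_erase_one_add_sign hζ1,
      prod_one_add_pow_mul hn hζ1 hζ2, Finset.mul_sum, Finset.sum_range]
    refine Finset.sum_congr rfl fun i _ => ?_
    rw [mul_pow]
    ring
  have hdet := congrArg (fun M => ‖Matrix.det M‖) hfactor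
  have hcdet := congrArg (fun M => ‖Matrix.det M‖) hCE
  simp only [Matrix.det_mul, Matrix.det_transpose, norm_mul, hVn] at hcdet
  have hLn : ∀ j, ‖L j‖ = 1 := fun j => by
    rw [hL, norm_prod]; exact Finset.prod_eq_one fun k _ => hl j k
  have hsgn : ‖((Equiv.Perm.sign σ : ℤ) : ℂ)‖ = 1 := by
    rcases Int.units_eq_one_or (Equiv.Perm.sign σ) with h | h <;> simp [h]
  simp only [Matrix.det_smul, Matrix.det_permute, Matrix.det_mul, Matrix.det_diagonal,
    Matrix.det_transpose, norm_mul, norm_prod, hLn, Finset.prod_const_one, one_mul, hsgn, norm_pow,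
    Complex.norm_real, Real.norm_of_nonneg (Real.sqrt_nonneg 2), ← hcdet, Fintype.card_fin] at hdet
  rw [← mul_assoc] at hdet
  have hdet := mul_right_cancel₀ (norm_ne_zero_iff.mpr hW0) hdet
  have hdet := congrArg (· ^ 2) hdet
  simp only [mul_pow, normSq_det_vandermonde_roots hω] at hdet
  rw [Finset.prod_range (fun l => ‖gaussCoeff ζ l‖), ← hdet]
  congr 1
  rw [← pow_mul, ← pow_mul, show (n - 1) * (n * 2) = 2 * (n * (n - 1)) by ring, pow_mul (√2),
    Real.sq_sqrt zero_le_two]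

/-! ### The logarithm of the determinant -/

/-- The function whose Riemann sums give the logarithm of the determinant of a regular polygon. -/
noncomputable def density (x : ℝ) : ℝ :=
  Real.log 2 + 2 * x * Real.log (Real.sin (Real.pi * x / 2)) +
    2 * (1 - x) * Real.log (Real.cos (Real.pi * x / 2))

theorem norm_one_sub_exp_mul_I (α : ℝ) :
    ‖1 - Complex.exp (α * Complex.I)‖ = 2 * |Real.sin (α / 2)| := by
  rw [norm_sub_rev, mul_comm, Complex.norm_exp_I_mul_ofReal_sub_one, norm_mul, Real.norm_eq_abs,
    Real.norm_eq_abs, abs_two]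

theorem norm_one_add_exp_mul_I (α : ℝ) :
    ‖1 + Complex.exp (α * Complex.I)‖ = 2 * |Real.cos (α / 2)| := by
  have h := norm_one_sub_exp_mul_I (α + Real.pi)
  have e : (((α + Real.pi : ℝ) : ℂ)) * Complex.I = α * Complex.I + Real.pi * Complex.I := by
    push_cast; ring
  rw [e, Complex.exp_add, Complex.exp_pi_mul_I, mul_neg_one, sub_neg_eq_add] at h
  rw [h, add_div, Real.sin_add_pi_div_two]

/-- Each a k is counted once for every l with k ≤ l < n. -/
theorem sum_range_sum_range_succ (a : ℕ → ℝ) (n : ℕ) :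
    ∑ l ∈ Finset.range n, ∑ k ∈ Finset.range l, a (k + 1) =
      ∑ k ∈ Finset.Ico 1 n, ((n : ℝ) - k) * a k := by
  induction n with
  | zero => simp
  | succ n ih =>
    rw [Finset.sum_range_succ, ih, Finset.range_eq_Ico, Finset.sum_Ico_add' a 0 n 1]
    rcases Nat.eq_zero_or_pos n with rfl | hn
    · simp
    rw [Finset.sum_Ico_succ_top (f := fun k => (((n + 1 : ℕ) : ℝ) - k) * a k) hn, zero_add,
      Finset.sum_Ico_succ_top (f := a) hn, ← add_assoc, ← Finset.sum_add_distrib]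
    congr 1
    · exact Finset.sum_congr rfl fun k _ => by push_cast; ring
    · push_cast; ring

theorem log_norm_det {n : ℕ} (hn : 0 < n) {x : Fin n → Space} (hx : IsRegularPolygon x) {D : ℂ}
    (hD : IsDet x D) :
    0 < ‖D‖ ∧ Real.log ‖D‖ = n / 2 * ∑ k ∈ Finset.Ico 1 n, density (k / n) := by
  have hn' : (0 : ℝ) < n := by exact_mod_cast hn
  have hkey := norm_sq_det hn hx hD
  set ζ := halfRoot n with hζ
  set s : ℕ → ℝ := fun k => Real.sin (Real.pi * (k / n) / 2) with hs
  set c : ℕ → ℝ := fun k => Real.cos (Real.pi * (k / n) / 2) with hc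
  have hpi := Real.pi_pos
  have hang : ∀ k ∈ Finset.Ico 1 n, 0 < Real.pi * ((k : ℝ) / n) / 2 ∧
      Real.pi * ((k : ℝ) / n) / 2 < Real.pi / 2 := by
    intro k hk
    rw [Finset.mem_Ico] at hk
    have hk0 : (0 : ℝ) < k := by exact_mod_cast hk.1
    have hk1 : (k : ℝ) / n < 1 := (div_lt_one hn').mpr (by exact_mod_cast hk.2)
    exact ⟨by positivity, by nlinarith⟩
  have hs0 : ∀ k ∈ Finset.Ico 1 n, 0 < s k := fun k hk =>
    Real.sin_pos_of_pos_of_lt_pi (hang k hk).1 (by linarith [(hang k hk).2])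
  have hc0 : ∀ k ∈ Finset.Ico 1 n, 0 < c k := fun k hk =>
    Real.cos_pos_of_mem_Ioo ⟨by linarith [(hang k hk).1], (hang k hk).2⟩
  have hsub : ∀ k ∈ Finset.Ico 1 n, ‖1 - ζ ^ k‖ = 2 * s k := fun k hk => by
    rw [hζ, halfRoot_pow, norm_one_sub_exp_mul_I, mul_div_assoc Real.pi, abs_of_pos (hs0 k hk)]
  have hadd : ∀ k ∈ Finset.Ico 1 n, ‖1 + ζ ^ k‖ = 2 * c k := fun k hk => by
    rw [hζ, halfRoot_pow, norm_one_add_exp_mul_I, mul_div_assoc Real.pi, abs_of_pos (hc0 k hk)]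
  have hgauss : ∀ l ∈ Finset.range n, 0 < ‖gaussCoeff ζ l‖ ∧ Real.log ‖gaussCoeff ζ l‖ =
      ∑ k ∈ Finset.range l, (Real.log (c (k + 1)) - Real.log (s (k + 1))) := by
    intro l hl
    have hmem : ∀ k ∈ Finset.range l, k + 1 ∈ Finset.Ico 1 n := fun k hk => by
      rw [Finset.mem_range] at hl hk
      exact Finset.mem_Ico.mpr ⟨by omega, by omega⟩
    have e : ‖gaussCoeff ζ l‖ = ∏ k ∈ Finset.range l, c (k + 1) / s (k + 1) := by
      rw [gaussCoeff, norm_prod]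
      refine Finset.prod_congr rfl fun k hk => ?_
      rw [norm_div, hsub _ (hmem k hk), hadd _ (hmem k hk), mul_div_mul_left _ _ two_ne_zero]
    rw [e]
    refine ⟨Finset.prod_pos fun k hk => div_pos (hc0 _ (hmem k hk)) (hs0 _ (hmem k hk)), ?_⟩
    rw [Real.log_prod (fun k hk => (div_pos (hc0 _ (hmem k hk)) (hs0 _ (hmem k hk))).ne')]
    exact Finset.sum_congr rfl fun k hk =>
      Real.log_div (hc0 _ (hmem k hk)).ne' (hs0 _ (hmem k hk)).ne'
  have hprod : 0 < ∏ l ∈ Finset.range n, ‖gaussCoeff ζ l‖ :=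
    Finset.prod_pos fun l hl => (hgauss l hl).1
  have hD0 : 0 < ‖D‖ := by
    rcases (norm_nonneg D).eq_or_lt with h | h
    · rw [← h] at hkey
      have : 0 < (n : ℝ) ^ n * (∏ l ∈ Finset.range n, ‖gaussCoeff ζ l‖) ^ 2 := by positivity
      rw [← hkey] at this
      simp at this
    · exact h
  refine ⟨hD0, ?_⟩
  have hlog := congrArg Real.log hkey
  rw [Real.log_mul (by positivity) (by positivity), Real.log_mul (by positivity) (by positivity),
    Real.log_pow, Real.log_pow, Real.log_pow, Real.log_pow,
    Real.log_prod (fun l hl => (hgauss l hl).1.ne'),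
    Finset.sum_congr rfl fun l hl => (hgauss l hl).2,
    sum_range_sum_range_succ (fun k => Real.log (c k) - Real.log (s k))] at hlog
  -- From n = ∏ (1 - ζ^{2k}) over 0 < k < n, with 1 - ζ^{2k} = (1 - ζ^k)(1 + ζ^k): this absorbs the
  -- factor n^n into the sum.
  have hord : Real.log n = ∑ k ∈ Finset.Ico 1 n,
      (2 * Real.log 2 + Real.log (s k) + Real.log (c k)) := by
    have hω : IsPrimitiveRoot (ζ ^ 2) (n - 1 + 1) := by
      rw [Nat.sub_add_cancel hn]
      exact (isPrimitiveRoot_halfRoot hn).pow (by omega) rfl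
    have h := congrArg (fun y : ℂ => Real.log ‖y‖) hω.prod_one_sub_pow_eq_order
    have hcast : (((n - 1 : ℕ) : ℂ) + 1) = n := by
      exact_mod_cast congrArg (Nat.cast (R := ℂ)) (Nat.sub_add_cancel hn)
    simp only [hcast, Complex.norm_natCast, norm_prod] at h
    rw [← h, Finset.range_eq_Ico, Finset.prod_Ico_add' (fun k => ‖1 - (ζ ^ 2) ^ k‖) 0 (n - 1) 1,
      Nat.sub_add_cancel hn, zero_add]
    have e : ∀ k ∈ Finset.Ico 1 n, ‖1 - (ζ ^ 2) ^ k‖ = 2 ^ 2 * s k * c k := fun k hk => by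
      rw [← pow_mul, mul_comm, pow_mul,
        show 1 - (ζ ^ k) ^ 2 = (1 - ζ ^ k) * (1 + ζ ^ k) by ring, norm_mul, hsub k hk, hadd k hk]
      ring
    rw [Finset.prod_congr rfl e, Real.log_prod (fun k hk => by
      have := hs0 k hk; have := hc0 k hk; positivity)]
    refine Finset.sum_congr rfl fun k hk => ?_
    have := hs0 k hk
    have := hc0 k hk
    rw [Real.log_mul (by positivity) (by positivity), Real.log_mul (by positivity) (by positivity),
      Real.log_pow]
    norm_num
  have hsymm : ∑ k ∈ Finset.Ico 1 n, Real.log (s k) = ∑ k ∈ Finset.Ico 1 n, Real.log (c k) := by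
    have h := Finset.sum_Ico_reflect (fun k => Real.log (s k)) 1 (Nat.le_succ n)
    rw [Nat.add_sub_cancel, Nat.add_sub_cancel_left] at h
    rw [← h]
    refine Finset.sum_congr rfl fun k hk => ?_
    rw [Finset.mem_Ico] at hk
    simp only [hs, hc]
    rw [← Real.sin_pi_div_two_sub, Nat.cast_sub hk.2.le]
    congr 2
    field_simp
  have hcard : ((n * (n - 1) : ℕ) : ℝ) * Real.log 2 =
      n * ∑ k ∈ Finset.Ico 1 n, Real.log 2 := by
    rw [Finset.sum_const, Nat.card_Ico, nsmul_eq_mul]; push_cast; ring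
  have hdens : (n : ℝ) * ∑ k ∈ Finset.Ico 1 n, density (k / n) = ∑ k ∈ Finset.Ico 1 n,
      (n * Real.log 2 + 2 * n * Real.log (s k)
        + 2 * (((n : ℝ) - k) * (Real.log (c k) - Real.log (s k)))) := by
    rw [Finset.mul_sum]
    refine Finset.sum_congr rfl fun k _ => ?_
    have : density (k / n) = Real.log 2 + 2 * (k / n) * Real.log (s k) +
        2 * (1 - k / n) * Real.log (c k) := rfl
    rw [this]
    field_simp
    ring
  rw [hcard, hord] at hlog
  simp only [Finset.sum_add_distrib, ← Finset.mul_sum] at hlog hdens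
  push_cast at hlog
  linear_combination hlog / 2 - hdens / 2 - n / 2 * hsymm

/-! ### Positivity of the density -/

open Real in
-- The expression decreases, since t < tan t, and vanishes at π/2. It is the numerator of a second
-- derivative in `log_cos_add_pos`.
theorem four_div_pi_mul_cos_add_pos {t : ℝ} (h0 : 0 ≤ t) (h1 : t < π / 2) :
    0 < 4 / π * cos t + 2 / π * (t * sin t) - 1 := by
  set φ : ℝ → ℝ := fun t => 4 / π * cos t + 2 / π * (t * sin t) - 1 with hφ
  have hd : ∀ t, HasDerivAt φ (2 / π * (t * cos t - sin t)) t := fun t => by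
    have := (((hasDerivAt_cos t).const_mul (4 / π)).add
      (((hasDerivAt_id t).mul (hasDerivAt_sin t)).const_mul (2 / π))).sub_const 1
    refine this.congr_deriv ?_
    simp only [id]
    ring
  have hanti : StrictAntiOn φ (Set.Icc 0 (π / 2)) := by
    refine strictAntiOn_of_deriv_neg (convex_Icc _ _)
      (fun t _ => (hd t).continuousAt.continuousWithinAt) fun t ht => ?_
    rw [interior_Icc] at ht
    rw [(hd t).deriv]
    have hc : 0 < cos t := cos_pos_of_mem_Ioo ⟨by linarith [ht.1, pi_pos], ht.2⟩
    have ht' := lt_tan ht.1 ht.2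
    rw [tan_eq_sin_div_cos, lt_div_iff₀ hc] at ht'
    exact mul_neg_of_pos_of_neg (by positivity) (by linarith)
  have h := hanti ⟨h0, h1.le⟩ ⟨by positivity, le_rfl⟩ h1
  have e : φ (π / 2) = 0 := by
    simp only [hφ, cos_pi_div_two, sin_pi_div_two]
    field_simp
    ring
  rwa [e] at h

open Real in
-- The function and its derivative G vanish at 0, and G' > 0.
theorem log_cos_add_pos {t : ℝ} (h0 : 0 < t) (h1 : t < π / 2) :
    0 < log (cos t) + t / π * (log (1 + sin t) - log (1 - sin t)) := by
  set L : ℝ → ℝ := fun t => log (1 + sin t) - log (1 - sin t) with hL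
  set F : ℝ → ℝ := fun t => log (cos t) + t / π * L t with hF
  set G : ℝ → ℝ := fun t => -tan t + (1 / π * L t + t / π * (2 / cos t)) with hG
  have hpi := pi_pos
  have hcos : ∀ t ∈ Set.Ico 0 (π / 2), 0 < cos t := fun t ht =>
    cos_pos_of_mem_Ioo ⟨by linarith [ht.1], ht.2⟩
  have hadd : ∀ t ∈ Set.Ico 0 (π / 2), 0 < 1 + sin t ∧ 0 < 1 - sin t := fun t ht => by
    have := hcos t ht
    have := sin_sq_add_cos_sq t
    constructor <;> nlinarith
  have dL : ∀ t ∈ Set.Ico 0 (π / 2), HasDerivAt L (2 / cos t) t := fun t ht => by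
    obtain ⟨ha, hb⟩ := hadd t ht
    have hc := hcos t ht
    have := (((hasDerivAt_sin t).const_add 1).log ha.ne').sub
      (((hasDerivAt_sin t).const_sub 1).log hb.ne')
    refine this.congr_deriv ?_
    have := sin_sq_add_cos_sq t
    field_simp
    linear_combination 2 * this
  have dF : ∀ t ∈ Set.Ico 0 (π / 2), HasDerivAt F (G t) t := fun t ht => by
    have hc := hcos t ht
    have := ((hasDerivAt_cos t).log hc.ne').add (((hasDerivAt_id t).div_const π).mul (dL t ht))
    refine this.congr_deriv ?_
    simp only [hG, tan_eq_sin_div_cos, id]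
    ring
  have dG : ∀ t ∈ Set.Ico 0 (π / 2),
      HasDerivAt G ((4 / π * cos t + 2 / π * (t * sin t) - 1) / cos t ^ 2) t := fun t ht => by
    have hc := hcos t ht
    have := (hasDerivAt_tan hc.ne').neg.add (((dL t ht).const_mul (1 / π)).add
      (((hasDerivAt_id t).div_const π).mul
        ((hasDerivAt_const t (2 : ℝ)).div (hasDerivAt_cos t) hc.ne')))
    refine this.congr_deriv ?_
    simp only [id, Pi.div_apply]
    field_simp
    ring
  have hGm : StrictMonoOn G (Set.Ico 0 (π / 2)) := by
    refine strictMonoOn_of_deriv_pos (convex_Ico _ _)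
      (fun t ht => (dG t ht).continuousAt.continuousWithinAt) fun t ht => ?_
    rw [interior_Ico] at ht
    have ht' : t ∈ Set.Ico 0 (π / 2) := ⟨ht.1.le, ht.2⟩
    rw [(dG t ht').deriv]
    exact div_pos (four_div_pi_mul_cos_add_pos ht'.1 ht'.2) (pow_pos (hcos t ht') 2)
  have hz : (0 : ℝ) ∈ Set.Ico 0 (π / 2) := ⟨le_rfl, by positivity⟩
  have hFm : StrictMonoOn F (Set.Ico 0 (π / 2)) := by
    refine strictMonoOn_of_deriv_pos (convex_Ico _ _)
      (fun t ht => (dF t ht).continuousAt.continuousWithinAt) fun t ht => ?_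
    rw [interior_Ico] at ht
    have ht' : t ∈ Set.Ico 0 (π / 2) := ⟨ht.1.le, ht.2⟩
    rw [(dF t ht').deriv]
    have := hGm hz ht' ht.1
    simpa [hG, hL] using this
  have := hFm hz ⟨h0.le, h1⟩ h0
  simpa [hF, hL] using this

open Real in
-- Half-angle formulas; centring at 1/2 makes the evenness in t visible.
theorem density_half_sub {t : ℝ} (h0 : -(π / 2) < t) (h1 : t < π / 2) :
    density (1 / 2 - t / π) =
      log (cos t) + t / π * (log (1 + sin t) - log (1 - sin t)) := by
  have hpi := pi_pos
  have hang : π * (1 / 2 - t / π) / 2 = (π / 2 - t) / 2 := by field_simp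
  have hs : 0 < sin ((π / 2 - t) / 2) := sin_pos_of_pos_of_lt_pi (by linarith) (by linarith)
  have hc : 0 < cos ((π / 2 - t) / 2) := cos_pos_of_mem_Ioo ⟨by linarith, by linarith⟩
  have hct : 0 < cos t := cos_pos_of_mem_Ioo ⟨h0, h1⟩
  have e1 : 1 - sin t = 2 * sin ((π / 2 - t) / 2) ^ 2 := by
    have := cos_sq' ((π / 2 - t) / 2)
    have h2 := cos_sq ((π / 2 - t) / 2)
    rw [mul_div_cancel₀ _ (two_ne_zero' ℝ), cos_pi_div_two_sub] at h2
    linarith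
  have e2 : 1 + sin t = 2 * cos ((π / 2 - t) / 2) ^ 2 := by
    have h2 := cos_sq ((π / 2 - t) / 2)
    rw [mul_div_cancel₀ _ (two_ne_zero' ℝ), cos_pi_div_two_sub] at h2
    linarith
  have e3 : cos t = 2 * sin ((π / 2 - t) / 2) * cos ((π / 2 - t) / 2) := by
    rw [← sin_two_mul, mul_div_cancel₀ _ (two_ne_zero' ℝ), sin_pi_div_two_sub]
  rw [density, hang, e1, e2, e3, log_mul (by positivity) (by positivity),
    log_mul (by positivity) (by positivity), log_mul (by positivity) (by positivity),
    log_mul (by positivity) (by positivity), log_pow, log_pow]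
  push_cast
  ring

open Real in
theorem density_pos {x : ℝ} (h0 : 0 < x) (h1 : x < 1) (h : x ≠ 1 / 2) : 0 < density x := by
  have hpi := pi_pos
  have hx : x = 1 / 2 - (π * (1 / 2 - x)) / π := by field_simp; ring
  rw [hx, density_half_sub (by nlinarith) (by nlinarith)]
  rcases lt_or_gt_of_ne h with h | h
  · exact log_cos_add_pos (by nlinarith) (by nlinarith)
  · have := log_cos_add_pos (t := -(π * (1 / 2 - x))) (by nlinarith) (by nlinarith)
    rw [cos_neg, sin_neg, sub_neg_eq_add, ← sub_eq_add_neg] at this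
    linear_combination this

open Real in
theorem density_nonneg {x : ℝ} (h0 : 0 < x) (h1 : x < 1) : 0 ≤ density x := by
  by_cases h : x = 1 / 2
  · have := density_half_sub (t := 0) (by linarith [pi_pos]) (by linarith [pi_pos])
    rw [h]
    simpa using this.ge
  · exact (density_pos h0 h1 h).le

theorem one_lt_norm_det {n : ℕ} (hn : 3 ≤ n) {x : Fin n → Space} (hx : IsRegularPolygon x) {D : ℂ}
    (hD : IsDet x D) : 1 < ‖D‖ := by
  obtain ⟨hpos, hlog⟩ := log_norm_det (by omega) hx hD
  have hn' : (3 : ℝ) ≤ n := by exact_mod_cast hn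
  rw [← Real.log_pos_iff hpos.le, hlog]
  refine mul_pos (by positivity) (Finset.sum_pos' (fun k hk => ?_)
    -- The term k = 1 is strictly positive because 1/n ≠ 1/2 for n ≥ 3.
    ⟨1, Finset.mem_Ico.mpr ⟨le_rfl, by omega⟩, ?_⟩)
  · rw [Finset.mem_Ico] at hk
    have hk0 : (0 : ℝ) < k := by exact_mod_cast hk.1
    exact density_nonneg (by positivity)
      ((div_lt_one (by positivity)).mpr (by exact_mod_cast hk.2))
  · rw [Nat.cast_one]
    refine density_pos (by positivity) ((div_lt_one (by positivity)).mpr (by linarith)) ?_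
    intro h
    field_simp at h
    linarith

/-! ### Numerical bounds -/

theorem hasSum_zeta_three :
    HasSum (fun n : ℕ => 1 / (n : ℝ) ^ 3) (riemannZeta 3).re := by
  have hs : Summable (fun n : ℕ => 1 / (n : ℝ) ^ 3) :=
    Real.summable_one_div_nat_pow.mpr (by norm_num)
  have h := zeta_nat_eq_tsum_of_gt_one (k := 3) (by norm_num)
  have e : riemannZeta 3 = ((∑' n : ℕ, 1 / (n : ℝ) ^ 3 : ℝ) : ℂ) := by
    rw [Complex.ofReal_tsum]
    simpa using h
  rw [e, Complex.ofReal_re]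
  exact hs.hasSum

/-- Partial sums of `ζ(3)` with an approximation of the tail. -/
noncomputable def zetaThreeApprox (m : ℕ) : ℝ :=
  ∑ k ∈ Finset.range m, 1 / ((k : ℝ) + 1) ^ 3 + 1 / (2 * (m : ℝ) ^ 2 + 2 * m + 1)

/-- The factorization 4y⁴ + 1 = (2y² + 2y + 1)(2y² - 2y + 1) at y = m + 1 collapses the increment to
order m⁻⁷. -/
theorem zetaThreeApprox_succ_sub (m : ℕ) : zetaThreeApprox (m + 1) - zetaThreeApprox m =
    1 / (((m : ℝ) + 1) ^ 3 * (4 * ((m : ℝ) + 1) ^ 4 + 1)) := by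
  rw [zetaThreeApprox, zetaThreeApprox, Finset.sum_range_succ]
  have h1 : (2 * ((m + 1 : ℕ) : ℝ) ^ 2 + 2 * (m + 1 : ℕ) + 1) ≠ 0 := by positivity
  have h2 : (2 * (m : ℝ) ^ 2 + 2 * m + 1) ≠ 0 := by positivity
  have h3 : (4 * ((m : ℝ) + 1) ^ 4 + 1) ≠ 0 := by positivity
  have h4 : 4 * ((m : ℝ) + 1) ^ 4 + 1 =
      (2 * ((m + 1 : ℕ) : ℝ) ^ 2 + 2 * (m + 1 : ℕ) + 1) * (2 * (m : ℝ) ^ 2 + 2 * m + 1) := by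
    push_cast; ring
  rw [h4]
  push_cast at h1 ⊢
  field_simp
  ring

theorem tendsto_zetaThreeApprox :
    Tendsto zetaThreeApprox atTop (𝓝 (riemannZeta 3).re) := by
  have h1 : Tendsto (fun m : ℕ => ∑ k ∈ Finset.range m, 1 / ((k : ℝ) + 1) ^ 3) atTop
      (𝓝 (riemannZeta 3).re) := by
    have h := (hasSum_nat_add_iff' 1).mpr hasSum_zeta_three
    simpa using h.tendsto_sum_nat
  have h2 : Tendsto (fun m : ℕ => 1 / (2 * (m : ℝ) ^ 2 + 2 * m + 1)) atTop (𝓝 0) := by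
    refine squeeze_zero (fun m => by positivity) (fun m => ?_)
      tendsto_one_div_add_atTop_nhds_zero_nat
    exact one_div_le_one_div_of_le (by positivity) (by nlinarith [sq_nonneg (m : ℝ)])
  have h := h1.add h2
  rwa [add_zero] at h

theorem zetaThreeApprox_le (m : ℕ) : zetaThreeApprox m ≤ (riemannZeta 3).re := by
  refine (monotone_nat_of_le_succ fun m => ?_).ge_of_tendsto tendsto_zetaThreeApprox m
  have h := zetaThreeApprox_succ_sub m
  have : (0 : ℝ) < 1 / (((m : ℝ) + 1) ^ 3 * (4 * ((m : ℝ) + 1) ^ 4 + 1)) := by positivity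
  linarith

/-- The increment is at most 1/(4(y + 1)⁷), less than the drop of 1/(24y⁶) from y to y + 1, so the
corrected sequence decreases to ζ(3). -/
theorem le_zetaThreeApprox_add (m : ℕ) :
    (riemannZeta 3).re ≤ zetaThreeApprox (m + 1) + 1 / (24 * ((m : ℝ) + 1) ^ 6) := by
  have hanti : Antitone fun m : ℕ => zetaThreeApprox (m + 1) + 1 / (24 * ((m : ℝ) + 1) ^ 6) := by
    refine antitone_nat_of_succ_le fun m => ?_
    have h := zetaThreeApprox_succ_sub (m + 1)
    push_cast at h ⊢
    set y : ℝ := (m : ℝ) + 1 with hy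
    have hy0 : 0 < y := by positivity
    have h1 : 1 / ((y + 1) ^ 3 * (4 * (y + 1) ^ 4 + 1)) ≤ 1 / (4 * (y + 1) ^ 7) :=
      one_div_le_one_div_of_le (by positivity) (by nlinarith [pow_pos (by positivity : 0 < y + 1) 3])
    have h2 : 1 / (24 * y ^ 6) - 1 / (24 * (y + 1) ^ 6) - 1 / (4 * (y + 1) ^ 7) =
        (21 * y ^ 5 + 35 * y ^ 4 + 35 * y ^ 3 + 21 * y ^ 2 + 7 * y + 1) /
          (24 * y ^ 6 * (y + 1) ^ 7) := by
      field_simp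
      ring
    have h3 : 0 ≤ (21 * y ^ 5 + 35 * y ^ 4 + 35 * y ^ 3 + 21 * y ^ 2 + 7 * y + 1) /
          (24 * y ^ 6 * (y + 1) ^ 7) := by positivity
    linarith
  have h2 : Tendsto (fun m : ℕ => 1 / (24 * ((m : ℝ) + 1) ^ 6)) atTop (𝓝 0) := by
    refine squeeze_zero (fun m => by positivity) (fun m => ?_)
      tendsto_one_div_add_atTop_nhds_zero_nat
    refine one_div_le_one_div_of_le (by positivity) ?_
    have : (1 : ℝ) ≤ (m : ℝ) + 1 := by linarith [(Nat.cast_nonneg m : (0 : ℝ) ≤ m)]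
    have := le_self_pow₀ this (n := 6) (by norm_num)
    linarith
  have ht := ((tendsto_add_atTop_iff_nat 1).mpr tendsto_zetaThreeApprox).add h2
  rw [add_zero] at ht
  exact hanti.le_of_tendsto ht m

theorem zeta_three_bounds :
    1.2020569024 < (riemannZeta 3).re ∧ (riemannZeta 3).re < 1.202056904 := by
  constructor
  · refine lt_of_lt_of_le ?_ (zetaThreeApprox_le 20)
    norm_num [zetaThreeApprox, Finset.sum_range_succ]
  · refine (le_zetaThreeApprox_add 19).trans_lt ?_
    norm_num [zetaThreeApprox, Finset.sum_range_succ]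

theorem limit_bounds :
    0.07970480 ≤ 7 * (riemannZeta 3).re / (2 * Real.pi ^ 2) - Real.log 2 / 2 ∧
      7 * (riemannZeta 3).re / (2 * Real.pi ^ 2) - Real.log 2 / 2 < 0.07970481 := by
  obtain ⟨z1, z2⟩ := zeta_three_bounds
  have p1 := Real.pi_gt_d20
  have p2 := Real.pi_lt_d20
  have l1 := Real.log_two_gt_d9
  have l2 := Real.log_two_lt_d9
  have q1 : (3.14159265358979323846 : ℝ) ^ 2 < Real.pi ^ 2 := by gcongr
  have q2 : Real.pi ^ 2 < (3.14159265358979323847 : ℝ) ^ 2 := by gcongr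
  have hq : 0 < 2 * Real.pi ^ 2 := by positivity
  constructor
  -- This is 0.07970480 plus half the upper bound for ln 2; the constant in the other half is
  -- 0.07970481 plus half the lower bound.
  · have : 0.4262783904 ≤ 7 * (riemannZeta 3).re / (2 * Real.pi ^ 2) := by
      rw [le_div_iff₀ hq]
      norm_num at q1 q2 z1 z2 ⊢
      linarith
    norm_num at *
    linarith
  · have : 7 * (riemannZeta 3).re / (2 * Real.pi ^ 2) < 0.42627840015 := by
      rw [div_lt_iff₀ hq]
      norm_num at q1 q2 z1 z2 ⊢
      linarith
    norm_num at *
    linarith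

/-! ### The integral of the density -/

open Real in
theorem sin_eq_mul_sinc (y : ℝ) : sin y = y * sinc y := by
  by_cases h : y = 0
  · simp [h]
  · rw [sinc_of_ne_zero h]; field_simp

open Real in
-- Write log(sin y) = log y + log(sinc y): y log y is continuous at 0 and sinc has no zero on the
-- interval.
theorem continuousOn_mul_log_sin :
    ContinuousOn (fun y => y * log (sin y)) (Set.Icc 0 (π / 2)) := by
  have hpos : ∀ y ∈ Set.Icc 0 (π / 2), sinc y ≠ 0 := fun y hy h => by
    rcases hy.1.eq_or_lt with h0 | h0
    · rw [← h0, sinc_zero] at h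
      exact one_ne_zero h
    · have h1 := sin_pos_of_pos_of_lt_pi h0 (by linarith [hy.2, pi_pos])
      rw [sin_eq_mul_sinc, h, mul_zero] at h1
      exact h1.false
  have hc : ContinuousOn (fun y => y * log y + y * log (sinc y)) (Set.Icc 0 (π / 2)) :=
    continuous_mul_log.continuousOn.add
      (continuousOn_id.mul (continuous_sinc.continuousOn.log hpos))
  refine hc.congr fun y hy => ?_
  by_cases h : y = 0
  · simp [h]
  · simp only
    rw [sin_eq_mul_sinc, log_mul h (hpos y hy), mul_add]

open Real in
theorem density_eq (x : ℝ) : density x = log 2 +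
    4 / π * ((π / 2 * x) * log (sin (π / 2 * x))) +
    4 / π * ((π / 2 - π / 2 * x) * log (sin (π / 2 - π / 2 * x))) := by
  have : π ≠ 0 := pi_ne_zero
  rw [density, sin_pi_div_two_sub, show π * x / 2 = π / 2 * x by ring]
  field_simp
  ring

open Real in
theorem continuousOn_density : ContinuousOn density (Set.Icc 0 1) := by
  have hpi := pi_pos
  have h1 : ContinuousOn (fun x => (π / 2 * x) * log (sin (π / 2 * x))) (Set.Icc 0 1) :=
    continuousOn_mul_log_sin.comp (f := fun x => π / 2 * x) (by fun_prop) fun x hx =>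
      ⟨by have := hx.1; positivity, by nlinarith [hx.2]⟩
  have h2 : ContinuousOn (fun x => (π / 2 - π / 2 * x) * log (sin (π / 2 - π / 2 * x)))
      (Set.Icc 0 1) :=
    continuousOn_mul_log_sin.comp (f := fun x => π / 2 - π / 2 * x) (by fun_prop) fun x hx =>
      ⟨by nlinarith [hx.2], by nlinarith [hx.1]⟩
  exact ((continuousOn_const.add (h1.const_mul _)).add (h2.const_mul _)).congr
    fun x _ => density_eq x

open Real in
-- It shows that sin(2my) cot y, which arises on integrating cos(2my) log(sin y) by parts, is a
-- cosine polynomial.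
theorem sin_two_mul_nat_mul_cos (m : ℕ) (y : ℝ) : sin (2 * m * y) * cos y =
    sin y * ∑ k ∈ Finset.range m, (cos (2 * k * y) + cos (2 * (k + 1 : ℕ) * y)) := by
  induction m with
  | zero => simp
  | succ m ih =>
    rw [Finset.sum_range_succ, mul_add, ← ih]
    have e1 : 2 * ((m + 1 : ℕ) : ℝ) * y = 2 * m * y + y + y := by push_cast; ring
    rw [e1, sin_add (2 * m * y + y), cos_add (2 * m * y + y), sin_add, cos_add]
    have := sin_sq_add_cos_sq y
    linear_combination (sin (2 * m * y) * cos y + cos (2 * m * y) * sin y) * this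

open Real in
theorem integral_cos_mul_log_sin {m : ℕ} (hm : 0 < m) :
    ∫ y in (0 : ℝ)..(π / 2), cos (2 * m * y) * log (sin y) = -π / (4 * m) := by
  have hpi := pi_pos
  have hm' : (m : ℝ) ≠ 0 := by positivity
  set P : ℕ → ℝ → ℝ := fun k y => if k = 0 then y else sin (2 * k * y) / (2 * k) with hP
  have dP : ∀ k y, HasDerivAt (P k) (cos (2 * k * y)) y := fun k y => by
    by_cases hk : k = 0
    · simp only [hP, hk, if_true]
      simpa using hasDerivAt_id' y
    · simp only [hP, hk, if_false]
      have hk' : (k : ℝ) ≠ 0 := by exact_mod_cast hk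
      have := (((hasDerivAt_id y).const_mul (2 * (k : ℝ))).sin).div_const (2 * (k : ℝ))
      refine this.congr_deriv ?_
      simp only [id]
      field_simp
  set Q : ℝ → ℝ := fun y => ∑ k ∈ Finset.range m, (P k y + P (k + 1) y) with hQ
  have dQ : ∀ y, HasDerivAt Q
      (∑ k ∈ Finset.range m, (cos (2 * k * y) + cos (2 * (k + 1 : ℕ) * y))) y := fun y =>
    HasDerivAt.fun_sum fun k _ => (dP k y).add (dP (k + 1) y)
  -- Integration by parts in closed form: Q is a primitive of sin(2my) cot y. At π/2 only the
  -- constant term of that polynomial contributes to Q.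
  set F : ℝ → ℝ := fun y => sin (2 * m * y) / (2 * m) * log (sin y) - 1 / (2 * m) * Q y with hF
  have hFc : ContinuousOn F (Set.Icc 0 (π / 2)) := by
    have h1 : ContinuousOn (fun y => sinc (2 * m * y) * (y * log (sin y))) (Set.Icc 0 (π / 2)) :=
      (continuous_sinc.comp (by fun_prop)).continuousOn.mul continuousOn_mul_log_sin
    have h2 : ContinuousOn (fun y => 1 / (2 * m) * Q y) (Set.Icc 0 (π / 2)) :=
      continuousOn_const.mul fun y _ => (dQ y).continuousAt.continuousWithinAt
    refine (h1.sub h2).congr fun y _ => ?_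
    simp only [hF, Pi.sub_apply]
    rw [sin_eq_mul_sinc (2 * m * y)]
    field_simp
  have hFd : ∀ y ∈ Set.Ioo 0 (π / 2), HasDerivAt F (cos (2 * m * y) * log (sin y)) y := by
    intro y hy
    have hs : sin y ≠ 0 := (sin_pos_of_pos_of_lt_pi hy.1 (by linarith [hy.2])).ne'
    have h1 := (((hasDerivAt_id y).const_mul (2 * (m : ℝ))).sin).div_const (2 * (m : ℝ))
    have h := (h1.mul ((hasDerivAt_sin y).log hs)).sub ((dQ y).const_mul (1 / (2 * (m : ℝ))))
    refine h.congr_deriv ?_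
    have e := sin_two_mul_nat_mul_cos m y
    generalize (∑ k ∈ Finset.range m, (cos (2 * k * y) + cos (2 * (k + 1 : ℕ) * y))) = S at e ⊢
    simp only [id]
    field_simp
    linear_combination e
  rw [intervalIntegral.integral_eq_sub_of_hasDerivAt_of_le (by positivity) hFc hFd
    (intervalIntegrable_log_sin.continuousOn_mul (by fun_prop))]
  have hsin : ∀ k : ℕ, sin (2 * k * (π / 2)) = 0 := fun k => by
    rw [show 2 * (k : ℝ) * (π / 2) = k * π by ring, sin_nat_mul_pi]
  have hQ1 : Q (π / 2) = π / 2 := by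
    have e : ∀ k, P k (π / 2) + P (k + 1) (π / 2) = if k = 0 then π / 2 else 0 := fun k => by
      by_cases hk : k = 0
      · subst hk; simp [hP, mul_div_cancel₀ π (two_ne_zero' ℝ)]
      · simp only [hP, hk, if_false, Nat.succ_ne_zero, hsin]; simp
    simp only [hQ, e]
    rw [Finset.sum_ite_eq' (Finset.range m) 0 (fun _ => π / 2),
      if_pos (Finset.mem_range.mpr hm)]
  have hQ0 : Q 0 = 0 := by
    simp [hQ, hP]
  simp only [hF, hQ1, hQ0, hsin, sin_zero, mul_zero]
  field_simp
  ring

open Real in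
-- With x = cy/π the quadratic is π² B₂(x) = ∑ cos(2πnx)/n², valid on [0, 1], whence c ≤ 2. The
-- series is integrated termwise against log(sin y), dominated by |log(sin y)|/n²; the term n = 0 is
-- zero by convention.
theorem hasSum_integral_quadratic_mul_log_sin {c : ℕ} (hc : 0 < c) (hc2 : c ≤ 2) :
    HasSum (fun n : ℕ => 1 / (n : ℝ) ^ 2 * (-π / (4 * (c * n : ℕ))))
      (∫ y in (0 : ℝ)..(π / 2), (c ^ 2 * y ^ 2 - c * π * y + π ^ 2 / 6) * log (sin y)) := by
  have hpi := pi_pos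
  have hsum : Summable fun n : ℕ => 1 / (n : ℝ) ^ 2 := summable_one_div_nat_pow.mpr one_lt_two
  have hint : IntervalIntegrable (fun y => log (sin y)) MeasureTheory.volume 0 (π / 2) :=
    intervalIntegrable_log_sin
  have hterm : ∀ n : ℕ, ∫ y in (0 : ℝ)..(π / 2),
      (1 / (n : ℝ) ^ 2 * cos (2 * (c * n : ℕ) * y)) * log (sin y) =
        1 / (n : ℝ) ^ 2 * (-π / (4 * (c * n : ℕ))) := fun n => by
    rcases Nat.eq_zero_or_pos n with rfl | hn
    · simp
    · simp only [mul_assoc (1 / (n : ℝ) ^ 2)]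
      rw [intervalIntegral.integral_const_mul, integral_cos_mul_log_sin (Nat.mul_pos hc hn)]
  simp only [← hterm]
  refine intervalIntegral.hasSum_integral_of_dominated_convergence
    (fun n y => 1 / (n : ℝ) ^ 2 * |log (sin y)|) ?_ ?_ ?_ ?_ ?_
  · intro n
    refine MeasureTheory.AEStronglyMeasurable.mul
      (Continuous.aestronglyMeasurable (by fun_prop)) ?_
    exact (Measurable.log measurable_sin).aestronglyMeasurable
  · intro n
    refine MeasureTheory.ae_of_all _ fun y _ => ?_
    rw [norm_mul, norm_mul, norm_eq_abs (log _), norm_of_nonneg (by positivity : 0 ≤ 1 / (n : ℝ) ^ 2)]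
    have := abs_cos_le_one (2 * (c * n : ℕ) * y)
    rw [mul_assoc]
    gcongr
    exact mul_le_of_le_one_left (abs_nonneg _) this
  · exact MeasureTheory.ae_of_all _ fun y _ => hsum.mul_right _
  · simp only [tsum_mul_right]
    exact hint.abs.const_mul _
  · refine MeasureTheory.ae_of_all _ fun y hy => ?_
    rw [Set.uIoc_of_le (by positivity)] at hy
    have hcR : (c : ℝ) ≤ 2 := by exact_mod_cast hc2
    have hx : (c : ℝ) * y / π ∈ Set.Icc (0 : ℝ) 1 := by
      refine ⟨by have := hy.1; positivity, (div_le_one hpi).mpr ?_⟩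
      nlinarith [hy.1, hy.2]
    have h := (hasSum_one_div_nat_pow_mul_cos one_ne_zero hx).mul_right (log (sin y))
    have hB : (Polynomial.map (algebraMap ℚ ℝ) (Polynomial.bernoulli (2 * 1))).eval (c * y / π) =
        (c * y / π) ^ 2 - c * y / π + 6⁻¹ := bernoulliFun_two _
    rw [hB] at h
    have hval : (-1 : ℝ) ^ (1 + 1) * (2 * π) ^ (2 * 1) / 2 / ((2 * 1 : ℕ).factorial : ℝ) *
        ((c * y / π) ^ 2 - c * y / π + 6⁻¹) * log (sin y) =
        (c ^ 2 * y ^ 2 - c * π * y + π ^ 2 / 6) * log (sin y) := by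
      congr 1
      rw [show (((2 * 1 : ℕ).factorial : ℕ) : ℝ) = 2 by norm_num [Nat.factorial]]
      field_simp
      ring
    rw [hval] at h
    refine h.congr_fun fun n => ?_
    rw [mul_one, show 2 * π * n * (c * y / π) = 2 * (c * n : ℕ) * y by push_cast; field_simp]

open Real in
theorem integral_quadratic_mul_log_sin {c : ℕ} (hc : 0 < c) (hc2 : c ≤ 2) :
    ∫ y in (0 : ℝ)..(π / 2), (c ^ 2 * y ^ 2 - c * π * y + π ^ 2 / 6) * log (sin y) =
      -π / (4 * c) * (riemannZeta 3).re := by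
  refine (hasSum_integral_quadratic_mul_log_sin hc hc2).unique ?_
  refine (hasSum_zeta_three.mul_left (-π / (4 * c))).congr_fun fun n => ?_
  push_cast
  ring

open Real in
theorem integral_mul_log_sin : ∫ y in (0 : ℝ)..(π / 2), y * log (sin y) =
    7 / 16 * (riemannZeta 3).re - π ^ 2 / 8 * log 2 := by
  have hpi := pi_pos
  have hint : ∀ p : ℝ → ℝ, Continuous p →
      IntervalIntegrable (fun y => p y * log (sin y)) MeasureTheory.volume 0 (π / 2) := fun p hp =>
    intervalIntegrable_log_sin.continuousOn_mul hp.continuousOn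
  have h1 := integral_quadratic_mul_log_sin one_pos one_le_two
  have h2 := integral_quadratic_mul_log_sin two_pos le_rfl
  have h0 := integral_log_sin_zero_pi_div_two
  -- The quadratic for c = 1 minus a quarter of that for c = 2 is -πy/2 + π²/8: the squares cancel.
  have key : ∫ y in (0 : ℝ)..(π / 2), (-π / 2) * (y * log (sin y)) =
      (∫ y in (0 : ℝ)..(π / 2),
        (((1 : ℕ) : ℝ) ^ 2 * y ^ 2 - ((1 : ℕ) : ℝ) * π * y + π ^ 2 / 6) * log (sin y)) -
      (∫ y in (0 : ℝ)..(π / 2), 1 / 4 *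
        ((((2 : ℕ) : ℝ) ^ 2 * y ^ 2 - ((2 : ℕ) : ℝ) * π * y + π ^ 2 / 6) * log (sin y))) -
      ∫ y in (0 : ℝ)..(π / 2), π ^ 2 / 8 * log (sin y) := by
    rw [← intervalIntegral.integral_sub (hint _ (by fun_prop))
      ((hint _ (by fun_prop)).const_mul _), ← intervalIntegral.integral_sub
      ((hint _ (by fun_prop)).sub ((hint _ (by fun_prop)).const_mul _)) (hint _ (by fun_prop))]
    congr 1
    funext y
    push_cast
    ring
  rw [intervalIntegral.integral_const_mul, intervalIntegral.integral_const_mul,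
    intervalIntegral.integral_const_mul, h1, h2, h0] at key
  push_cast at key
  have : (∫ y in (0 : ℝ)..(π / 2), y * log (sin y)) =
      (-2 / π) * (-π / 2 * ∫ y in (0 : ℝ)..(π / 2), y * log (sin y)) := by
    field_simp
  rw [this, key]
  field_simp
  ring

open Real in
theorem integral_density : ∫ x in (0 : ℝ)..1, density x =
    7 * (riemannZeta 3).re / π ^ 2 - log 2 := by
  have hpi := pi_pos
  have hK : IntervalIntegrable (fun y => y * log (sin y)) MeasureTheory.volume 0 (π / 2) :=
    intervalIntegrable_log_sin.continuousOn_mul continuousOn_id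
  set K : ℝ → ℝ := fun y => y * log (sin y) with hKd
  have e1 : ∫ x in (0 : ℝ)..1, K (π / 2 * x) = (π / 2)⁻¹ * ∫ y in (0 : ℝ)..(π / 2), K y := by
    rw [intervalIntegral.integral_comp_mul_left K (by positivity)]
    simp
  have e2 : ∫ x in (0 : ℝ)..1, K (π / 2 - π / 2 * x) =
      (π / 2)⁻¹ * ∫ y in (0 : ℝ)..(π / 2), K y := by
    rw [intervalIntegral.integral_comp_sub_mul K (by positivity)]
    simp
  have c1 : ContinuousOn (fun x => K (π / 2 * x)) (Set.uIcc 0 1) := by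
    rw [Set.uIcc_of_le zero_le_one]
    exact continuousOn_mul_log_sin.comp (f := fun x => π / 2 * x) (by fun_prop) fun x hx =>
      ⟨by have := hx.1; positivity, by nlinarith [hx.2]⟩
  have c2 : ContinuousOn (fun x => K (π / 2 - π / 2 * x)) (Set.uIcc 0 1) := by
    rw [Set.uIcc_of_le zero_le_one]
    exact continuousOn_mul_log_sin.comp (f := fun x => π / 2 - π / 2 * x) (by fun_prop)
      fun x hx => ⟨by nlinarith [hx.2], by nlinarith [hx.1]⟩
  have hd : density = fun x => log 2 + 4 / π * K (π / 2 * x) + 4 / π * K (π / 2 - π / 2 * x) :=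
    funext density_eq
  rw [hd, intervalIntegral.integral_add
    (intervalIntegrable_const.add (c1.intervalIntegrable.const_mul _))
    (c2.intervalIntegrable.const_mul _), intervalIntegral.integral_add intervalIntegrable_const
    (c1.intervalIntegrable.const_mul _), intervalIntegral.integral_const_mul,
    intervalIntegral.integral_const_mul, e1, e2, integral_mul_log_sin,
    intervalIntegral.integral_const]
  field_simp
  ring

/-! ### Riemann sums -/

theorem tendsto_riemann_sum {f : ℝ → ℝ} (hf : ContinuousOn f (Set.Icc 0 1)) :
    Tendsto (fun n : ℕ => (∑ k ∈ Finset.range n, f (k / n)) / n) atTop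
      (𝓝 (∫ x in (0 : ℝ)..1, f x)) := by
  have huc := isCompact_Icc.uniformContinuousOn_of_continuous hf
  rw [Metric.uniformContinuousOn_iff] at huc
  rw [Metric.tendsto_atTop]
  intro ε hε
  obtain ⟨δ, hδ, hclose⟩ := huc (ε / 2) (half_pos hε)
  obtain ⟨N, hN⟩ := exists_nat_gt (1 / δ)
  refine ⟨N, fun n hn => ?_⟩
  have hNR : (N : ℝ) ≤ n := by exact_mod_cast hn
  have hn0 : (0 : ℝ) < n := lt_of_lt_of_le (lt_trans (by positivity) hN) hNR
  have hnδ : 1 / (n : ℝ) < δ := by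
    rw [div_lt_comm₀ hn0 hδ]; linarith
  have hsub : ∀ k < n, Set.Icc ((k : ℝ) / n) ((k + 1 : ℕ) / n) ⊆ Set.Icc 0 1 := fun k hk => by
    refine Set.Icc_subset_Icc (by positivity) ((div_le_one hn0).mpr ?_)
    exact_mod_cast hk
  have hle : ∀ k : ℕ, (k : ℝ) / n ≤ (k + 1 : ℕ) / n := fun k => by
    gcongr; simp
  have hint : ∀ k < n, IntervalIntegrable f MeasureTheory.volume ((k : ℝ) / n) ((k + 1 : ℕ) / n) :=
    fun k hk => ContinuousOn.intervalIntegrable (by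
      rw [Set.uIcc_of_le (hle k)]; exact hf.mono (hsub k hk))
  have hsplit := intervalIntegral.sum_integral_adjacent_intervals
    (a := fun k : ℕ => (k : ℝ) / n) hint
  simp only [Nat.cast_zero, zero_div, div_self hn0.ne'] at hsplit
  have hlen : ∀ k : ℕ, ((k + 1 : ℕ) : ℝ) / n - k / n = 1 / n := fun k => by
    push_cast; ring
  rw [Real.dist_eq, ← hsplit, Finset.sum_div, ← Finset.sum_sub_distrib]
  have hbound : ∀ k ∈ Finset.range n,
      |f (k / n) / n - ∫ x in ((k : ℝ) / n)..((k + 1 : ℕ) / n), f x| ≤ ε / 2 * (1 / n) := by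
    intro k hk
    rw [Finset.mem_range] at hk
    have e : f (k / n) / n = ∫ x in ((k : ℝ) / n)..((k + 1 : ℕ) / n), f (k / n) := by
      rw [intervalIntegral.integral_const, hlen, smul_eq_mul]; ring
    rw [e, ← intervalIntegral.integral_sub intervalIntegrable_const (hint k hk)]
    have := intervalIntegral.norm_integral_le_of_norm_le_const
      (f := fun x => f (k / n) - f x) (C := ε / 2) (a := (k : ℝ) / n) (b := (k + 1 : ℕ) / n)
      fun x hx => by
        rw [Set.uIoc_of_le (hle k)] at hx
        refine (hclose _ (hsub k hk ⟨le_rfl, hle k⟩) _ (hsub k hk ⟨hx.1.le, hx.2⟩) ?_).le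
        rw [Real.dist_eq, abs_sub_comm, abs_of_nonneg (by linarith [hx.1])]
        have := hlen k
        linarith [hx.2]
    rwa [hlen, abs_of_pos (by positivity), Real.norm_eq_abs] at this
  calc |∑ k ∈ Finset.range n, (f (k / n) / n - ∫ x in ((k : ℝ) / n)..((k + 1 : ℕ) / n), f x)|
      ≤ ∑ k ∈ Finset.range n, |f (k / n) / n - ∫ x in ((k : ℝ) / n)..((k + 1 : ℕ) / n), f x| :=
        Finset.abs_sum_le_sum_abs _ _
    _ ≤ ∑ k ∈ Finset.range n, ε / 2 * (1 / n) := Finset.sum_le_sum hbound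
    _ = ε / 2 := by
        rw [Finset.sum_const, Finset.card_range, nsmul_eq_mul]; field_simp
    _ < ε := half_lt_self hε

theorem tendsto_sum_density : Tendsto
    (fun n : ℕ => ((n : ℝ) / 2 * ∑ k ∈ Finset.Ico 1 n, density (k / n)) / (n : ℝ) ^ 2) atTop
    (𝓝 (7 * (riemannZeta 3).re / (2 * Real.pi ^ 2) - Real.log 2 / 2)) := by
  have h1 := tendsto_riemann_sum continuousOn_density
  rw [integral_density] at h1
  -- The Riemann sum includes k = 0 and the determinant formula does not; the difference is
  -- negligible.
  have h2 : Tendsto (fun n : ℕ => density 0 / n) atTop (𝓝 0) :=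
    tendsto_const_div_atTop_nhds_zero_nat _
  have h := (h1.sub h2).div_const 2
  have e : (7 * (riemannZeta 3).re / Real.pi ^ 2 - Real.log 2 - 0) / 2 =
      7 * (riemannZeta 3).re / (2 * Real.pi ^ 2) - Real.log 2 / 2 := by
    have := Real.pi_pos
    field_simp
    ring
  rw [e] at h
  refine h.congr' ?_
  filter_upwards [eventually_gt_atTop 0] with n hn
  have hn' : (n : ℝ) ≠ 0 := by exact_mod_cast hn.ne'
  rw [Finset.range_eq_Ico, Finset.sum_eq_sum_Ico_succ_bot hn]
  simp only [Nat.cast_zero, zero_div, zero_add]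
  field_simp
  ring

end Atiyah

/-! ### The theorem -/

theorem theorem2p4 (D : ℕ → ℝ)
    (hD : ∀ n : ℕ, 3 ≤ n → ∃ (x : Fin n → Atiyah.Space) (d : ℂ),
      Atiyah.IsRegularPolygon x ∧ Atiyah.IsDet x d ∧ D n = ‖d‖) :
    (∀ n : ℕ, 3 ≤ n → ∀ (x : Fin n → Atiyah.Space) (d : ℂ),
      Atiyah.IsRegularPolygon x → Atiyah.IsDet x d → ‖d‖ = D n) ∧
    Tendsto (fun n : ℕ => Real.log (D n) / (n : ℝ) ^ 2) atTop
      (𝓝 (7 * (riemannZeta 3).re / (2 * Real.pi ^ 2) - Real.log 2 / 2)) ∧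
    (0.07970480 ≤ 7 * (riemannZeta 3).re / (2 * Real.pi ^ 2) - Real.log 2 / 2 ∧
      7 * (riemannZeta 3).re / (2 * Real.pi ^ 2) - Real.log 2 / 2 < 0.07970481) ∧
    ∀ n : ℕ, 3 ≤ n → 1 < D n := by
  refine ⟨fun n hn x d hx hd => ?_, ?_, Atiyah.limit_bounds, fun n hn => ?_⟩
  · obtain ⟨x', d', hx', hd', h⟩ := hD n hn
    obtain ⟨hp, hl⟩ := Atiyah.log_norm_det (by omega) hx hd
    obtain ⟨hp', hl'⟩ := Atiyah.log_norm_det (by omega) hx' hd'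
    rw [h]
    exact Real.log_injOn_pos hp hp' (hl.trans hl'.symm)
  · refine Atiyah.tendsto_sum_density.congr' ?_
    filter_upwards [eventually_ge_atTop 3] with n hn
    obtain ⟨x, d, hx, hd, h⟩ := hD n hn
    rw [h, (Atiyah.log_norm_det (by omega) hx hd).2]
  · obtain ⟨x, d, hx, hd, h⟩ := hD n hn
    rw [h]
    exact Atiyah.one_lt_norm_det hn hx hd
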